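/- Let $\mathbb{K}$ be a commutative ring with unity. Algebras are associative but need not have a unity. A $\mathbb{K}$-algebra with enough idempotents (w.e.i.) is a pair $(R,\{e_i\}_{i\in I})$ with $\{e_i\}$ a family of orthogonal idempotents of the $\mathbb{K}$-algebra $R$ such that $R=\bigoplus_i e_iR=\bigoplus_i Re_i$. It is basic if every $e_jRe_i$ is a $\mathbb{K}$-module of finite length, every $e_i$ is primitive, and $Re_i\not\simeq Re_j$ for $i\neq j$. $\mathrm{Mod}(R)$ is the category of unitary left $R$-modules ($RN=N$), and $\mathrm{pd}$ is the projective dimension in $\mathrm{Mod}(R)$. For $N\in\mathrm{Mod}(R)$ let $\mathrm{Supp}(N)=\{i: e_iN\neq 0\}$. $R$ is support finite if $\mathrm{Supp}(Re_i)$ and $\mathrm{Supp}(e_iR)$ are finite for all $i$. $N$ is endofinite if every $e_iN$ has finite length over the endomorphism ring of $N$, acting by evaluation; these notions are used likewise for right modules. $R$ is locally bounded if every $e_i$ is primitive, every $Re_i$ and every $e_iR$ is endofinite, and $R$ is support finite. $\mathcal{P}^{<\infty}_R$ is the class of finitely generated $N\in\mathrm{Mod}(R)$ with $\mathrm{pd}(N)<\infty$.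 For a class $\mathcal{X}$ of modules, $\mathrm{pd}(\mathcal{X})=\sup\{\mathrm{pd}(N):N\in\mathcal{X}\}$, and $\mathrm{fin.dim.}(R)=\mathrm{pd}(\mathcal{P}^{<\infty}_R)$ (possibly $\infty$). $\mathcal{F}(\mathcal{X})$ is the class of $N\in\mathrm{Mod}(R)$ having a finite chain of submodules $0=N_0\subseteq\dots\subseteq N_n=N$ with every $N_k/N_{k-1}$ isomorphic to an object of $\mathcal{X}$. For a basic w.e.i. algebra $(R,\{e_i\}_{i\in I})$ and a partition $\tilde{\mathcal{A}}=\{\tilde{\mathcal{A}}_a\}_{a}$ of $I$ indexed by a well-ordered set (for instance by the ordinals $a<\alpha$), put, for $t\in\tilde{\mathcal{A}}_a$, $\Delta_t(a)=Re_t/\mathrm{Tr}_a(Re_t)$, where $\mathrm{Tr}_a(Re_t)$ is the trace in $Re_t$ of $\bigoplus_{b<a}\bigoplus_{r\in\tilde{\mathcal{A}}_b}Re_r$. Let $\Delta(a)=\{\Delta_t(a):t\in\tilde{\mathcal{A}}_a\}$ and ${}_{\tilde{\mathcal{A}}}\Delta=\bigcup_a\Delta(a)$. $(R,\tilde{\mathcal{A}})$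 is left standardly stratified if $\mathrm{Tr}_a(Re_t)\in\mathcal{F}(\bigcup_{b<a}\Delta(b))$ for all $a$ and $t\in\tilde{\mathcal{A}}_a$. Theorem. Let $(U,\{e_i\}_{i\in I})$ and $(T,\{f_j\}_{j\in J})$ be basic w.e.i. $\mathbb{K}$-algebras and let $M$ be a unitary $U$-$T$-bimodule on which $\mathbb{K}$ acts centrally, such that every $e_iMf_j$ is a $\mathbb{K}$-module of finite length and the left $U$-module $Mf_j$ satisfies $\mathrm{pd}(Mf_j)<\infty$ for every $j\in J$. Let $\Lambda=\left[\begin{smallmatrix}T&0\\M&U\end{smallmatrix}\right]$ be the lower triangular matrix $\mathbb{K}$-algebra with the family of idempotents indexed by the disjoint union $I\vee J$ consisting of $\left[\begin{smallmatrix}0&0\\0&e_i\end{smallmatrix}\right]$ $(i\in I)$ and $\left[\begin{smallmatrix}f_j&0\\0&0\end{smallmatrix}\right]$ $(j\in J)$, and assume that $\Lambda$ is support finite. Let $\tilde{\mathcal{A}}=\{\tilde{\mathcal{A}}_a\}_{a<\alpha}$ and $\tilde{\mathcal{B}}=\{\tilde{\mathcal{B}}_b\}_{b<\beta}$ be partitions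 of $I$ and $J$ indexed by ordinals, and let $\tilde{\mathcal{C}}=\tilde{\mathcal{A}}\vee\tilde{\mathcal{B}}$ be the partition of $I\vee J$ that consists of the blocks of $\tilde{\mathcal{A}}$ followed by those of $\tilde{\mathcal{B}}$ (index set $[0,\alpha)\vee[0,\beta)$, all elements of $[0,\alpha)$ being smaller than all elements of $[0,\beta)$). Then the following are equivalent: (a) $\mathcal{F}({}_{\tilde{\mathcal{C}}}\Delta)=\mathcal{P}^{<\infty}_\Lambda$; (b) $\mathcal{F}({}_{\tilde{\mathcal{A}}}\Delta)=\mathcal{P}^{<\infty}_U$ and $\mathcal{F}({}_{\tilde{\mathcal{B}}}\Delta)=\mathcal{P}^{<\infty}_T$. Moreover, if these conditions hold, then $\Lambda$, $U$ and $T$ are locally bounded, $(\Lambda,\tilde{\mathcal{C}})$, $(U,\tilde{\mathcal{A}})$ and $(T,\tilde{\mathcal{B}})$ are left standardly stratified (in particular $\Lambda$ is a basic w.e.i. $\mathbb{K}$-algebra), and $\mathrm{fin.dim.}(\Lambda)=\mathrm{pd}({}_{\tilde{\mathcal{C}}}\Delta)$, $\mathrm{fin.dim.}(T)=\mathrm{pd}({}_{\tilde{\mathcal{B}}}\Delta)$,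 $\mathrm{fin.dim.}(U)=\mathrm{pd}({}_{\tilde{\mathcal{A}}}\Delta)$. -/

import Mathlib

open scoped DirectSum

universe u v w

/-! ### Modules over rings without unit

A left module over a (not necessarily unital) ring `R`, i.e. an abelian group with a biadditive
associative action of `R`, is literally the same thing as a unital module over the ring
`ℤ ⊕ R` obtained from `R` by adjoining a unit; `r : R` acts as `(Unitization.inr r)`.
Submodules, homomorphisms, quotients and finite generation are the same for both. -/

/-- The ring `ℤ ⊕ R`; its (unital) modules are the left `R`-modules. -/
def Dorroh (R : Type u) [NonUnitalRing R] : Type u := Unitization ℤ R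

noncomputable instance (R : Type u) [NonUnitalRing R] : Ring (Dorroh R) :=
  inferInstanceAs (Ring (Unitization ℤ R))

section ToD

variable {R : Type u} [NonUnitalRing R]

/-- The element of `Dorroh R` given by `r : R`. -/
def toD (r : R) : Dorroh R := (Unitization.inr r : Unitization ℤ R)

@[simp] theorem toD_zero : toD (0 : R) = 0 := Unitization.inr_zero ℤ

@[simp] theorem toD_add (r s : R) : toD (r + s) = toD r + toD s := Unitization.inr_add ℤ r s

@[simp] theorem toD_mul (r s : R) : toD (r * s) = toD r * toD s := Unitization.inr_mul ℤ r s

theorem toD_injective : Function.Injective (toD : R → Dorroh R) := Unitization.inr_injective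

/-- `R` is a left ideal of `Dorroh R`. -/
theorem exists_mul_toD (c : Dorroh R) (r : R) : ∃ s : R, c * toD r = toD s := by
  have key : ∀ c : Unitization ℤ R, ∃ s : R, c * (Unitization.inr r : Unitization ℤ R) =
      Unitization.inr s := fun c =>
    ⟨(c * (Unitization.inr r : Unitization ℤ R)).toProd.2, Unitization.ext (by simp) rfl⟩
  exact key c

end ToD

/-- Classes of left `R`-modules. -/
abbrev ModClass (R : Type u) [NonUnitalRing R] := CategoryTheory.ObjectProperty (ModuleCat.{u} (Dorroh R))

section Modules

variable (R : Type u) [NonUnitalRing R]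

/-- `M` is unitary: `R M = M`. -/
def IsUnitary (M : Type*) [AddCommGroup M] [Module (Dorroh R) M] : Prop :=
  AddSubgroup.closure {x : M | ∃ (r : R) (m : M), x = toD r • m} = ⊤

variable {R}

/-- `P` is a projective object of the category `Mod(R)` of unitary left `R`-modules. -/
def IsProj (P : ModuleCat.{u} (Dorroh R)) : Prop :=
  IsUnitary R P ∧ ∀ X Y : ModuleCat.{u} (Dorroh R), IsUnitary R X → IsUnitary R Y →
    ∀ (g : X →ₗ[Dorroh R] Y) (f : P →ₗ[Dorroh R] Y), Function.Surjective g →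
      ∃ h : P →ₗ[Dorroh R] X, g ∘ₗ h = f

/-- `N` has a resolution `0 → P_n → ⋯ → P_0 → N → 0` by projective objects of `Mod(R)`. -/
def HasPdLE : ℕ → ModuleCat.{u} (Dorroh R) → Prop
  | 0, N => IsProj N
  | n + 1, N => ∃ (P : ModuleCat.{u} (Dorroh R)) (p : P →ₗ[Dorroh R] N),
      IsProj P ∧ Function.Surjective p ∧
        HasPdLE n (ModuleCat.of (Dorroh R) (LinearMap.ker p))

/-- The projective dimension of a module in `Mod(R)` (`⊤` if there is no finite resolution). -/
noncomputable def pd (N : ModuleCat.{u} (Dorroh R)) : ℕ∞ :=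
  ⨅ (n : ℕ) (_ : HasPdLE n N), (n : ℕ∞)

/-- `pd(𝒞) = sup {pd(C) : C ∈ 𝒞}`. -/
noncomputable def pdClass (𝒞 : ModClass R) : ℕ∞ := ⨆ (N : ModuleCat.{u} (Dorroh R)) (_ : 𝒞 N), pd N

variable (R) in
/-- The class `𝒫^{<∞}_R` of the finitely generated unitary modules of finite projective
dimension. -/
def finPd : ModClass R := fun N => IsUnitary R N ∧ Module.Finite (Dorroh R) N ∧ pd N < ⊤

variable (R) in
/-- The small finitistic dimension of `R`. -/
noncomputable def finDim : ℕ∞ := pdClass (finPd R)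

/-- The class `𝓕_f(Θ)` of the unitary modules `N` with a finite chain
`0 = c 0 ⊆ c 1 ⊆ ⋯ ⊆ c n = N` of submodules all of whose factors are isomorphic to objects
of `Θ`. -/
def Filt (Θ : ModClass R) : ModClass R := fun N =>
  IsUnitary R N ∧ ∃ (n : ℕ) (c : ℕ → Submodule (Dorroh R) N), c 0 = ⊥ ∧ c n = ⊤ ∧
    ∀ k < n, c k ≤ c (k + 1) ∧ ∃ X : ModuleCat.{u} (Dorroh R), Θ X ∧
      Nonempty ((c (k + 1) ⧸ (c k).submoduleOf (c (k + 1))) ≃ₗ[Dorroh R] X)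

/-- The trace `Tr_X(N)`: the sum of the images of all homomorphisms `X → N`. -/
noncomputable def traceMod (X N : Type*) [AddCommGroup X] [Module (Dorroh R) X] [AddCommGroup N]
    [Module (Dorroh R) N] : Submodule (Dorroh R) N :=
  ⨆ φ : X →ₗ[Dorroh R] N, LinearMap.range φ

end Modules

/-! ### Algebras with enough idempotents -/

section Algebras

variable {R : Type u} [NonUnitalRing R] {I : Type v} (e : I → R)

/-- `e_i R`. -/
def rightIdeal (i : I) : AddSubgroup R := (AddMonoidHom.mulLeft (e i)).range

/-- `R e_i`. -/
def leftIdeal (i : I) : AddSubgroup R := (AddMonoidHom.mulRight (e i)).range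

/-- `(R, {e_i})` is a ring with enough idempotents: the `e_i` are orthogonal idempotents and
`R = ⨁ e_i R = ⨁ R e_i`. -/
structure IsWEI : Prop where
  idem : ∀ i, e i * e i = e i
  ortho : ∀ i j, i ≠ j → e i * e j = 0
  right_indep : iSupIndep (rightIdeal e)
  right_top : ⨆ i, rightIdeal e i = ⊤
  left_indep : iSupIndep (leftIdeal e)
  left_top : ⨆ i, leftIdeal e i = ⊤

/-- A primitive idempotent: it is nonzero and not the sum of two nonzero orthogonal
idempotents. -/
def IsPrimitiveIdem (x : R) : Prop :=
  x * x = x ∧ x ≠ 0 ∧ ∀ a b : R, a * a = a → b * b = b → a * b = 0 → b * a = 0 → x = a + b →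
    a = 0 ∨ b = 0

/-- The left `R`-module `R e_i`, realised inside `Dorroh R`, which contains `R` as a left
ideal. -/
noncomputable def projMod (i : I) : Submodule (Dorroh R) (Dorroh R) where
  carrier := {x | ∃ r : R, x = toD (r * e i)}
  zero_mem' := ⟨0, by simp⟩
  add_mem' := by
    rintro _ _ ⟨r, rfl⟩ ⟨s, rfl⟩
    exact ⟨r + s, by simp [add_mul]⟩
  smul_mem' := by
    rintro c _ ⟨r, rfl⟩
    obtain ⟨s, hs⟩ := exists_mul_toD c r
    exact ⟨s, by rw [smul_eq_mul, toD_mul, toD_mul, ← mul_assoc, hs]⟩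

/-- `e_j R e_i` as a `K`-submodule of the `K`-algebra `R`. -/
def corner (K : Type w) [CommRing K] [Module K R] [IsScalarTower K R R] [SMulCommClass K R R]
    (j i : I) : Submodule K R :=
  LinearMap.range (LinearMap.mulLeft K (e j) ∘ₗ LinearMap.mulRight K (e i))

/-- `(R, {e_i})` is a basic `K`-algebra with enough idempotents. -/
structure IsBasic (K : Type w) [CommRing K] [Module K R] [IsScalarTower K R R]
    [SMulCommClass K R R] : Prop where
  wei : IsWEI e
  homFinite : ∀ j i, IsFiniteLength K (corner e K j i)
  primitive : ∀ i, IsPrimitiveIdem (e i)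
  noniso : ∀ i j, i ≠ j → IsEmpty (projMod e i ≃ₗ[Dorroh R] projMod e j)

/-- The same family of idempotents in the opposite ring. -/
def opFam (i : I) : Rᵐᵒᵖ := MulOpposite.op (e i)

/-- `Supp(N) = {i : e_i N ≠ 0}`. -/
def supp (N : Type*) [AddCommGroup N] [Module (Dorroh R) N] : Set I :=
  {i | ∃ n : N, toD (e i) • n ≠ 0}

/-- `R` is left support finite: every `Supp(R e_i)` is finite. -/
def IsLeftSupportFinite : Prop := ∀ i, (supp e (projMod e i)).Finite

/-- `R` is left and right support finite. The right `R`-modules `e_i R` are the left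
`Rᵐᵒᵖ`-modules `Rᵐᵒᵖ e_i`. -/
def IsSupportFinite : Prop := IsLeftSupportFinite e ∧ IsLeftSupportFinite (opFam e)

/-- `e_i N` as a module over the endomorphism ring of the `R`-module `N`, which acts by
evaluation. -/
def endoPart (N : Type*) [AddCommGroup N] [Module (Dorroh R) N] (i : I) :
    Submodule (Module.End (Dorroh R) N) N where
  carrier := {x | ∃ n : N, x = toD (e i) • n}
  zero_mem' := ⟨0, by simp⟩
  add_mem' := by
    rintro _ _ ⟨r, rfl⟩ ⟨s, rfl⟩
    exact ⟨r + s, by simp⟩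
  smul_mem' := by
    rintro c _ ⟨r, rfl⟩
    exact ⟨c r, by simp⟩

/-- The module `N` is endofinite. -/
def IsEndofinite (N : Type*) [AddCommGroup N] [Module (Dorroh R) N] : Prop :=
  ∀ i, IsFiniteLength (Module.End (Dorroh R) N) (endoPart e N i)

/-- Every `R e_i` is endofinite. -/
def IsLeftLocallyEndofinite : Prop := ∀ i, IsEndofinite e (projMod e i)

/-- `(R, {e_i})` is a locally bounded ring with enough idempotents. -/
structure IsLocallyBounded : Prop where
  wei : IsWEI e
  primitive : ∀ i, IsPrimitiveIdem (e i)
  left_endofinite : IsLeftLocallyEndofinite e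
  right_endofinite : IsLeftLocallyEndofinite (opFam e)
  supportFinite : IsSupportFinite e

end Algebras

/-! ### Partitions and standard modules -/

/-- `A` is a partition of `I` into nonempty pairwise disjoint sets, indexed by `ι`. -/
structure IsPartition {ι : Type*} {I : Type*} (A : ι → Set I) : Prop where
  nonempty : ∀ i, (A i).Nonempty
  disjoint : ∀ i j, i ≠ j → Disjoint (A i) (A j)
  cover : ∀ t, ∃ i, t ∈ A i

/-- The joint partition of the disjoint union: its index set is the ordered sum of the two
index sets. -/
def joinPart {ι κ I J : Type*} (A : ι → Set I) (B : κ → Set J) : ι ⊕ₗ κ → Set (I ⊕ J) :=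
  fun x => Sum.elim (fun i => Sum.inl '' A i) (fun j => Sum.inr '' B j) (ofLex x)

section Standard

variable {R : Type u} [NonUnitalRing R] {I : Type v} (e : I → R)
variable {ι : Type w} [LT ι] (A : ι → Set I)

/-- `⨁_{j < i} ⨁_{r ∈ A_j} R e_r`. -/
abbrev lowerProj (i : ι) : Type _ := ⨁ (j : {j : ι // j < i}), ⨁ (r : A j.1), projMod e r.1

/-- The trace of `⨁_{j < i} ⨁_{r ∈ A_j} R e_r` in `R e_t`. -/
noncomputable def stdTrace (i : ι) (t : I) : Submodule (Dorroh R) (projMod e t) :=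
  traceMod (lowerProj e A i) (projMod e t)

/-- The standard module `Δ_t(i)`, for `t ∈ A_i`. -/
noncomputable def stdMod (i : ι) (t : I) : ModuleCat.{u} (Dorroh R) :=
  ModuleCat.of (Dorroh R) (projMod e t ⧸ stdTrace e A i t)

/-- The class `⋃_{i ∈ S} Δ(i)`, where `Δ(i) = {Δ_t(i) : t ∈ A_i}`. -/
def stdClassOn (S : Set ι) : ModClass R := fun X => ∃ i ∈ S, ∃ t ∈ A i, X = stdMod e A i t

/-- The class of all standard modules. -/
def stdClass : ModClass R := stdClassOn e A Set.univ

/-- `(R, A)` is a left standardly stratified `K`-algebra. -/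
structure IsStandardlyStratified (K : Type*) [CommRing K] [Module K R] [IsScalarTower K R R]
    [SMulCommClass K R R] : Prop where
  basic : IsBasic e K
  partition : IsPartition A
  trace_filt : ∀ i, ∀ t ∈ A i,
    Filt (stdClassOn e A {j | j < i}) (ModuleCat.of (Dorroh R) (stdTrace e A i t))

end Standard

/-! ### Lower triangular matrix algebras -/

/-- The scalar action of `K` on the left `R`-module `M` is compatible with the action of the
`K`-algebra `R`: `(k r) m = k (r m) = r (k m)`. -/
class CentralAction (K : Type*) (R : Type u) (M : Type*) [CommRing K] [NonUnitalRing R]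
    [Module K R] [AddCommGroup M] [Module K M] [Module (Dorroh R) M] : Prop where
  smul_left : ∀ (k : K) (r : R) (m : M), toD (k • r) • m = k • (toD r • m)
  smul_right : ∀ (k : K) (r : R) (m : M), toD r • (k • m) = k • (toD r • m)

/-- The matrices with rows `(t, 0)` and `(m, u)`. -/
@[ext]
structure TriMat (T M U : Type u) : Type u where
  /-- the upper left entry -/
  t : T
  /-- the lower left entry -/
  m : M
  /-- the lower right entry -/
  u : U

namespace TriMat

/-- A matrix as a triple of entries; used to transport the componentwise addition. -/
def equivProd (T M U : Type u) : TriMat T M U ≃ T × M × U where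
  toFun x := (x.t, x.m, x.u)
  invFun x := ⟨x.1, x.2.1, x.2.2⟩

section Additive

variable {T M U : Type u} [AddCommGroup T] [AddCommGroup U] [AddCommGroup M]

instance : AddCommGroup (TriMat T M U) := (equivProd T M U).addCommGroup

instance (K : Type w) [CommRing K] [Module K T] [Module K M] [Module K U] :
    Module K (TriMat T M U) := (equivProd T M U).module K

@[simp] theorem add_t (x y : TriMat T M U) : (x + y).t = x.t + y.t := rfl
@[simp] theorem add_m (x y : TriMat T M U) : (x + y).m = x.m + y.m := rfl
@[simp] theorem add_u (x y : TriMat T M U) : (x + y).u = x.u + y.u := rfl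
@[simp] theorem zero_t : (0 : TriMat T M U).t = 0 := rfl
@[simp] theorem zero_m : (0 : TriMat T M U).m = 0 := rfl
@[simp] theorem zero_u : (0 : TriMat T M U).u = 0 := rfl

section

variable {K : Type w} [CommRing K] [Module K T] [Module K M] [Module K U]

@[simp] theorem smul_t (k : K) (x : TriMat T M U) : (k • x).t = k • x.t := rfl
@[simp] theorem smul_m (k : K) (x : TriMat T M U) : (k • x).m = k • x.m := rfl
@[simp] theorem smul_u (k : K) (x : TriMat T M U) : (k • x).u = k • x.u := rfl

end

end Additive

/-! A right `T`-module is a left `Tᵐᵒᵖ`-module; `m t` is `toD (MulOpposite.op t) • m`. -/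

variable {T M U : Type u} [NonUnitalRing T] [NonUnitalRing U] [AddCommGroup M]
variable [Module (Dorroh U) M] [Module (Dorroh Tᵐᵒᵖ) M]

noncomputable instance : Mul (TriMat T M U) :=
  ⟨fun x y => ⟨x.t * y.t, toD (MulOpposite.op y.t) • x.m + toD x.u • y.m, x.u * y.u⟩⟩

@[simp] theorem mul_t (x y : TriMat T M U) : (x * y).t = x.t * y.t := rfl
@[simp] theorem mul_m (x y : TriMat T M U) :
    (x * y).m = toD (MulOpposite.op y.t) • x.m + toD x.u • y.m := rfl
@[simp] theorem mul_u (x y : TriMat T M U) : (x * y).u = x.u * y.u := rfl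

noncomputable instance [SMulCommClass (Dorroh U) (Dorroh Tᵐᵒᵖ) M] : NonUnitalRing (TriMat T M U) :=
  { (inferInstance : AddCommGroup (TriMat T M U)), (inferInstance : Mul (TriMat T M U)) with
    left_distrib := fun x y z => by
      ext <;> simp [mul_add, add_smul]
      abel
    right_distrib := fun x y z => by
      ext <;> simp [add_mul, add_smul]
      abel
    zero_mul := fun x => by ext <;> simp
    mul_zero := fun x => by ext <;> simp
    mul_assoc := fun x y z => by
      ext
      · simp [mul_assoc]
      · simp only [mul_m, mul_t, mul_u, MulOpposite.op_mul, toD_mul, mul_smul, smul_add,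
          smul_comm (toD x.u) (toD (MulOpposite.op z.t)) y.m, add_assoc]
      · simp [mul_assoc] }

variable (K : Type w) [CommRing K] [Module K T] [Module K M] [Module K U]
variable [CentralAction K U M] [CentralAction K Tᵐᵒᵖ M]
variable [SMulCommClass (Dorroh U) (Dorroh Tᵐᵒᵖ) M]

instance [IsScalarTower K T T] [IsScalarTower K U U] :
    IsScalarTower K (TriMat T M U) (TriMat T M U) :=
  ⟨fun k x y => by
    ext <;> simp [CentralAction.smul_left, CentralAction.smul_right, smul_mul_assoc]⟩

instance [SMulCommClass K T T] [SMulCommClass K U U] :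
    SMulCommClass K (TriMat T M U) (TriMat T M U) :=
  ⟨fun k x y => by
    ext <;> simp [CentralAction.smul_left, CentralAction.smul_right, mul_smul_comm]⟩

/-- The idempotents `g_r` of the triangular matrix algebra, for `r` in the disjoint union. -/
def idem {I J : Type*} (M : Type u) [AddCommGroup M] (e : I → U) (f : J → T) :
    I ⊕ J → TriMat T M U :=
  Sum.elim (fun i => ⟨0, 0, e i⟩) (fun j => ⟨f j, 0, 0⟩)

end TriMat

section Bimodule

variable (U : Type u) {T : Type u} (M : Type u) [NonUnitalRing U] [NonUnitalRing T] [AddCommGroup M]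
variable [Module (Dorroh U) M] [Module (Dorroh Tᵐᵒᵖ) M]
variable {J : Type*} (f : J → T)

/-- The left `U`-module `M f_j`. -/
def colMod [SMulCommClass (Dorroh U) (Dorroh Tᵐᵒᵖ) M] (j : J) : Submodule (Dorroh U) M where
  carrier := {x | ∃ m : M, x = toD (MulOpposite.op (f j)) • m}
  zero_mem' := ⟨0, by simp⟩
  add_mem' := by
    rintro _ _ ⟨r, rfl⟩ ⟨s, rfl⟩
    exact ⟨r + s, by simp⟩
  smul_mem' := by
    rintro c _ ⟨r, rfl⟩
    exact ⟨c • r, smul_comm _ _ _⟩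

variable {U} in
/-- The `K`-module `e_i M f_j`. -/
def biCorner {I : Type*} (e : I → U) (K : Type w) [CommRing K] [Module K U] [Module K T] [Module K M]
    [CentralAction K U M] [CentralAction K Tᵐᵒᵖ M] (i : I) (j : J) : Submodule K M where
  carrier := {x | ∃ m : M, x = toD (e i) • toD (MulOpposite.op (f j)) • m}
  zero_mem' := ⟨0, by simp⟩
  add_mem' := by
    rintro _ _ ⟨r, rfl⟩ ⟨s, rfl⟩
    exact ⟨r + s, by simp⟩
  smul_mem' := by
    rintro c _ ⟨r, rfl⟩
    exact ⟨c • r, by simp only [CentralAction.smul_right]⟩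

end Bimodule

section

open CategoryTheory

/-! ### The Dorroh extension -/

section DorrohExtension

variable {R S : Type u} [NonUnitalRing R] [NonUnitalRing S]

/-! After adjoining a unit, unitary `R`-modules form a full subcategory of the `Dorroh R`-modules,
closed under submodules and quotients. Each is covered by a direct sum of modules `R e_i`, which are
projective over `Dorroh R`. Hence the projective dimension in Mod(R) is the one over `Dorroh R`
(`IsWEI.hasPdLE_iff`), and the usual calculus of short exact sequences applies.

In a unitary Λ-module N the elements killed by T form a submodule `uPart N`. Λ acts on it through U
and on the quotient N / `uPart N` through T. The resulting functors `lower` and `upper` are exact on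
unitary modules, and both classes of the theorem can be tested on them: N lies in F(Δ) over Λ iff
`lower N` and `upper N` lie in F(Δ) over U and T (`TriMat.filt_iff`), and the same holds for
finitely generated modules of finite projective dimension (`TriMat.finPd_iff`). So (b) implies (a),
while (a) implies (b) by applying (a) to modules inflated from U or T.

For F(Δ): the blocks of I come first, so the standard modules of Λ are the inflated standard modules
of U and T. Indeed Λe_i is inflated from Ue_i, and the trace of the Λe_i in Λf_j swallows Mf_j.

For finite projective dimension: inflation from U preserves and reflects projective dimension. Over
T, the sequence 0 → Mf_j → Λf_j → Tf_j → 0 and pd(Mf_j) < ∞ give Tf_j finite projective dimension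
over Λ, which then passes to every finitely generated T-module of finite projective dimension
(`exists_pdLE_pull`). Conversely `upper` carries projective resolutions over Λ to projective
resolutions over T. Finite generation of `uPart N` holds because support finiteness and finite
length of the corners make the Λe Noetherian.

For the supplement: `K` acts on e_jRe_i through endomorphisms of Re_i, so finite length over `K`
gives endofiniteness. The trace Tr_a(Re_t) is the kernel of Re_t → Δ_t(a), hence finitely generated
of finite projective dimension, hence in F(Δ); `exists_lower_filt` then shows that only factors
below a are needed. Finally, a bound on projective dimension passes along filtrations
(`pdClass_filt`). -/

theorem Dorroh.exists_eq (d : Dorroh R) : ∃ (n : ℤ) (r : R), d = (n : Dorroh R) + toD r := by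
  have key : ∀ d : Unitization ℤ R, ∃ (n : ℤ) (r : R),
      d = (n : Unitization ℤ R) + Unitization.inr r := fun d => by
    refine ⟨d.fst, d.snd, ?_⟩
    have h : ((d.fst : ℤ) : Unitization ℤ R) = Unitization.inl d.fst :=
      (eq_intCast (Unitization.inlRingHom ℤ R) d.fst).symm
    rw [h]
    exact (Unitization.inl_fst_add_inr_snd_eq d).symm
  exact key d

/-- The unital ring homomorphism between Dorroh extensions induced by a ring homomorphism. -/
noncomputable def Dorroh.map (φ : R →ₙ+* S) : Dorroh R →+* Dorroh S :=
  let ψ : R →ₙₐ[ℤ] Unitization ℤ S :=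
    (Unitization.inrNonUnitalAlgHom ℤ S).comp { φ with map_smul' := fun n r => map_zsmul φ n r }
  (Unitization.lift ψ : Unitization ℤ R →ₐ[ℤ] Unitization ℤ S).toRingHom

@[simp] theorem Dorroh.map_toD (φ : R →ₙ+* S) (r : R) : Dorroh.map φ (toD r) = toD (φ r) := by
  let ψ : R →ₙₐ[ℤ] Unitization ℤ S :=
    (Unitization.inrNonUnitalAlgHom ℤ S).comp { φ with map_smul' := fun n r => map_zsmul φ n r }
  have h : Unitization.lift ψ (Unitization.inr r) = ψ r := by simp
  exact h

variable {N N' : Type*} [AddCommGroup N] [Module (Dorroh R) N] [AddCommGroup N']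
  [Module (Dorroh R) N']

theorem Dorroh.smul_eq (n : ℤ) (r : R) (x : N) :
    ((n : Dorroh R) + toD r) • x = n • x + toD r • x := by
  rw [add_smul, Int.cast_smul_eq_zsmul]

/-- An additive map that commutes with the action of `R` is linear over `Dorroh R`. -/
def linOfToD (f : N →+ N') (hf : ∀ (r : R) (n : N), f (toD r • n) = toD r • f n) :
    N →ₗ[Dorroh R] N' :=
  { f with
    map_smul' := fun d n => by
      obtain ⟨k, r, rfl⟩ := Dorroh.exists_eq d
      simp [Dorroh.smul_eq, hf] }

/-- An additive subgroup stable under the action of `R` is a submodule over `Dorroh R`. -/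
def subOfToD (H : AddSubgroup N) (hH : ∀ (r : R), ∀ n ∈ H, toD r • n ∈ H) :
    Submodule (Dorroh R) N :=
  { H with
    smul_mem' := fun d n hn => by
      obtain ⟨k, r, rfl⟩ := Dorroh.exists_eq d
      rw [Dorroh.smul_eq]
      exact H.add_mem (H.zsmul_mem hn k) (hH r n hn) }

theorem Dorroh.map_surjective {φ : R →ₙ+* S} (hφ : Function.Surjective φ) :
    Function.Surjective (Dorroh.map φ) := fun d => by
  obtain ⟨k, r, rfl⟩ := Dorroh.exists_eq d
  obtain ⟨s, rfl⟩ := hφ r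
  exact ⟨k + toD s, by simp⟩

end DorrohExtension

/-! ### Short exact sequences of modules -/

/-- `0 → L → N → X → 0` is exact. -/
structure IsSES {S : Type*} [Ring S] {L N X : Type*} [AddCommGroup L] [AddCommGroup N]
    [AddCommGroup X] [Module S L] [Module S N] [Module S X] (i : L →ₗ[S] N) (g : N →ₗ[S] X) :
    Prop where
  inj : Function.Injective i
  surj : Function.Surjective g
  exact : ∀ n, g n = 0 ↔ ∃ l, i l = n

section SES

variable {S : Type*} [Ring S] {L N X : Type*} [AddCommGroup L] [AddCommGroup N]
    [AddCommGroup X] [Module S L] [Module S N] [Module S X]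

theorem isSES_ker (g : N →ₗ[S] X) (hg : Function.Surjective g) :
    IsSES (LinearMap.ker g).subtype g :=
  ⟨Subtype.val_injective, hg, fun n => by simp⟩

theorem isSES_mkQ (L : Submodule S N) : IsSES L.subtype L.mkQ :=
  ⟨Subtype.val_injective, L.mkQ_surjective, fun n => by simp⟩

theorem IsSES.comp_eq_zero {i : L →ₗ[S] N} {g : N →ₗ[S] X} (h : IsSES i g) (l : L) :
    g (i l) = 0 := (h.exact _).2 ⟨l, rfl⟩

end SES

/-! ### Projective dimension in short exact sequences -/

section SESPd

variable {S : Type u} [Ring S] {L N X : ModuleCat.{u} S} {i : L →ₗ[S] N} {g : N →ₗ[S] X}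

theorem IsSES.shortExact (h : IsSES i g) :
    (ShortComplex.mk (ModuleCat.ofHom i) (ModuleCat.ofHom g)
      (by ext l; exact h.comp_eq_zero l)).ShortExact :=
  ModuleCat.shortComplex_shortExact _ (fun n => h.exact n) h.inj h.surj

theorem IsSES.pdLE_mid (h : IsSES i g) {n : ℕ} (hL : HasProjectiveDimensionLE L n)
    (hX : HasProjectiveDimensionLE X n) : HasProjectiveDimensionLE N n :=
  h.shortExact.hasProjectiveDimensionLT_X₂ _ hL hX

theorem IsSES.pdLE_right (h : IsSES i g) {n : ℕ} (hL : HasProjectiveDimensionLE L n)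
    (hN : HasProjectiveDimensionLE N (n + 1)) : HasProjectiveDimensionLE X (n + 1) :=
  h.shortExact.hasProjectiveDimensionLT_X₃ _ hL hN

theorem IsSES.pdLE_left (h : IsSES i g) {n : ℕ} (hN : HasProjectiveDimensionLE N n)
    (hX : HasProjectiveDimensionLE X (n + 1)) : HasProjectiveDimensionLE L n :=
  h.shortExact.hasProjectiveDimensionLT_X₁ _ hN hX

theorem pdLE_of_equiv (f : L ≃ₗ[S] N) {n : ℕ} (hL : HasProjectiveDimensionLE L n) :
    HasProjectiveDimensionLE N n :=
  hasProjectiveDimensionLT_of_iso f.toModuleIso _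

theorem pdLE_mono {n m : ℕ} (h : n ≤ m) (hL : HasProjectiveDimensionLE L n) :
    HasProjectiveDimensionLE L m :=
  hasProjectiveDimensionLT_of_ge _ (n + 1) _ (by omega)

theorem pdLE_zero_iff : HasProjectiveDimensionLE L 0 ↔ Module.Projective S L := by
  rw [← projective_iff_hasProjectiveDimensionLE_zero, IsProjective.iff_projective]

end SESPd

/-! ### Unitary modules -/

section Unitary

variable {R : Type u} [NonUnitalRing R]

section

variable {N N' : Type*} [AddCommGroup N] [Module (Dorroh R) N] [AddCommGroup N']
  [Module (Dorroh R) N']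

theorem IsUnitary.of_surjective (hN : IsUnitary R N) (g : N →ₗ[Dorroh R] N')
    (hg : Function.Surjective g) : IsUnitary R N' := by
  rw [IsUnitary, eq_top_iff]
  rintro x -
  obtain ⟨n, rfl⟩ := hg x
  have hn : n ∈ AddSubgroup.closure {x : N | ∃ (r : R) (m : N), x = toD r • m} := by
    rw [hN]; trivial
  induction hn using AddSubgroup.closure_induction with
  | mem x hx =>
    obtain ⟨r, m, rfl⟩ := hx
    exact AddSubgroup.subset_closure ⟨r, g m, by simp⟩
  | zero => simp
  | add x y _ _ hx hy => rw [map_add]; exact add_mem hx hy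
  | neg x _ hx => rw [map_neg]; exact neg_mem hx

theorem IsUnitary.directSum {κ : Type*} {F : κ → Type*} [∀ k, AddCommGroup (F k)]
    [∀ k, Module (Dorroh R) (F k)] (h : ∀ k, IsUnitary R (F k)) : IsUnitary R (⨁ k, F k) := by
  classical
  rw [IsUnitary, eq_top_iff]
  rintro x -
  induction x using DirectSum.induction_on with
  | zero => exact zero_mem _
  | add x y hx hy => exact add_mem hx hy
  | of k x =>
    have hn : x ∈ AddSubgroup.closure {x : F k | ∃ (r : R) (m : F k), x = toD r • m} := by
      rw [h k]; trivial
    induction hn using AddSubgroup.closure_induction with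
    | mem x hx =>
      obtain ⟨r, m, rfl⟩ := hx
      exact AddSubgroup.subset_closure ⟨r, DirectSum.lof (Dorroh R) κ F k m, by
        rw [← map_smul]; rfl⟩
    | zero => simp
    | add x y _ _ hx hy => rw [map_add]; exact add_mem hx hy
    | neg x _ hx => rw [map_neg]; exact neg_mem hx

end

section

variable {I : Type v} {e : I → R} (he : IsWEI e)
variable {N N' : Type*} [AddCommGroup N] [Module (Dorroh R) N] [AddCommGroup N']
  [Module (Dorroh R) N']
include he

theorem IsWEI.smul_self (i : I) (n : N) : toD (e i) • toD (e i) • n = toD (e i) • n := by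
  rw [← mul_smul, ← toD_mul, he.idem]

theorem IsWEI.smul_ne {i j : I} (h : i ≠ j) (n : N) : toD (e i) • toD (e j) • n = 0 := by
  rw [← mul_smul, ← toD_mul, he.ortho i j h, toD_zero, zero_smul]

/-- Since R is the sum of the `e_i R`, finitely many `e_i` act on r as a left unit. Stability under
enlarging the finite set is what lets two such sets be merged when elements are added. -/
theorem IsWEI.exists_unit_smul (r : R) (n : N) :
    ∃ s : Finset I, ∀ s', s ⊆ s' → ∑ i ∈ s', toD (e i) • toD r • n = toD r • n := by
  classical
  have hr : r ∈ ⨆ i, rightIdeal e i := by rw [he.right_top]; trivial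
  induction hr using AddSubgroup.iSup_induction' with
  | hp i x hx =>
    obtain ⟨y, rfl⟩ := hx
    refine ⟨{i}, fun s' hs' => ?_⟩
    rw [AddMonoidHom.coe_mulLeft, toD_mul, mul_smul]
    rw [Finset.sum_eq_single i (fun j _ hj => he.smul_ne hj _)
      (fun h => absurd (hs' (Finset.mem_singleton_self i)) h), he.smul_self]
  | h1 => exact ⟨∅, by simp⟩
  | hadd x y _ _ hx hy =>
    obtain ⟨s, hs⟩ := hx
    obtain ⟨t, ht⟩ := hy
    refine ⟨s ∪ t, fun s' hs' => ?_⟩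
    simp only [toD_add, add_smul, smul_add, Finset.sum_add_distrib]
    rw [hs s' (Finset.union_subset_left hs'), ht s' (Finset.union_subset_right hs')]

theorem IsUnitary.exists_unit (hN : IsUnitary R N) (n : N) :
    ∃ s : Finset I, ∀ s', s ⊆ s' → ∑ i ∈ s', toD (e i) • n = n := by
  classical
  have hn : n ∈ AddSubgroup.closure {x : N | ∃ (r : R) (m : N), x = toD r • m} := by
    rw [hN]; trivial
  induction hn using AddSubgroup.closure_induction with
  | mem x hx =>
    obtain ⟨r, m, rfl⟩ := hx
    exact he.exists_unit_smul r m
  | zero => exact ⟨∅, by simp⟩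
  | add x y _ _ hx hy =>
    obtain ⟨s, hs⟩ := hx
    obtain ⟨t, ht⟩ := hy
    refine ⟨s ∪ t, fun s' hs' => ?_⟩
    simp only [smul_add, Finset.sum_add_distrib]
    rw [hs s' (Finset.union_subset_left hs'), ht s' (Finset.union_subset_right hs')]
  | neg x _ hx =>
    obtain ⟨s, hs⟩ := hx
    refine ⟨s, fun s' hs' => ?_⟩
    simp only [smul_neg, Finset.sum_neg_distrib]
    rw [hs s' hs']

omit he in
theorem isUnitary_of_unit (e : I → R) (h : ∀ n : N, ∃ s : Finset I, ∑ i ∈ s, toD (e i) • n = n) :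
    IsUnitary R N := by
  rw [IsUnitary, eq_top_iff]
  rintro n -
  obtain ⟨s, hs⟩ := h n
  rw [← hs]
  exact sum_mem fun i _ => AddSubgroup.subset_closure ⟨e i, n, rfl⟩

theorem IsUnitary.eq_zero (hN : IsUnitary R N) {n : N} (h : ∀ i, toD (e i) • n = 0) : n = 0 := by
  obtain ⟨s, hs⟩ := IsUnitary.exists_unit he hN n
  rw [← hs s subset_rfl]
  exact Finset.sum_eq_zero fun i _ => h i

/-- Having local units is an elementwise condition, so it passes to submodules; for the condition RN
= N alone this is not apparent. -/
theorem IsUnitary.of_injective (hN : IsUnitary R N) (g : N' →ₗ[Dorroh R] N)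
    (hg : Function.Injective g) : IsUnitary R N' := by
  refine isUnitary_of_unit e fun n => ?_
  obtain ⟨s, hs⟩ := IsUnitary.exists_unit he hN (g n)
  exact ⟨s, hg (by simpa using hs s subset_rfl)⟩

theorem IsUnitary.submodule (hN : IsUnitary R N) (L : Submodule (Dorroh R) N) : IsUnitary R L :=
  IsUnitary.of_injective he hN L.subtype L.subtype_injective

end

/-! ### The modules `R e_i` -/

section ProjMod

variable {I : Type v} {e : I → R} {N : Type*} [AddCommGroup N] [Module (Dorroh R) N]

variable (e) in
/-- The homomorphism `R e_i → N`, `x ↦ x n`. -/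
noncomputable def projHom (i : I) (n : N) : projMod e i →ₗ[Dorroh R] N :=
  (LinearMap.toSpanSingleton (Dorroh R) N n).comp (projMod e i).subtype

theorem projHom_apply (i : I) (n : N) (x : projMod e i) : projHom e i n x = (x : Dorroh R) • n :=
  rfl

/-- The generator `e_i` of `R e_i`. -/
noncomputable def projGen {i : I} (h : e i * e i = e i) : projMod e i :=
  ⟨toD (e i), e i, by rw [h]⟩

theorem coe_projGen {i : I} (h : e i * e i = e i) : (projGen h : Dorroh R) = toD (e i) := rfl

theorem projMod_mul {i : I} (h : e i * e i = e i) (x : projMod e i) :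
    (x : Dorroh R) * toD (e i) = x := by
  obtain ⟨_, r, rfl⟩ := x
  change toD (r * e i) * toD (e i) = toD (r * e i)
  rw [← toD_mul, mul_assoc, h]

theorem projMod_eq_smul {i : I} (h : e i * e i = e i) (x : projMod e i) :
    x = (x : Dorroh R) • projGen h :=
  Subtype.ext (projMod_mul h x).symm

theorem projHom_gen {i : I} (h : e i * e i = e i) (n : N) :
    projHom e i n (projGen h) = toD (e i) • n := rfl

/-- Right multiplication by `e i` retracts `Dorroh R` onto `R e_i`. -/
theorem projective_projMod {i : I} (h : e i * e i = e i) :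
    Module.Projective (Dorroh R) (projMod e i) :=
  Module.Projective.of_split (projMod e i).subtype
    (LinearMap.toSpanSingleton (Dorroh R) (projMod e i) (projGen h))
    (by ext x; exact congrArg Subtype.val (projMod_eq_smul h x).symm)

theorem isUnitary_projMod {i : I} (h : e i * e i = e i) : IsUnitary R (projMod e i) := by
  rw [IsUnitary, eq_top_iff]
  rintro ⟨_, r, rfl⟩ -
  exact AddSubgroup.subset_closure ⟨r, projGen h, Subtype.ext (toD_mul r (e i))⟩

theorem IsWEI.exists_cover (he : IsWEI e) (N : ModuleCat.{u} (Dorroh R)) (hN : IsUnitary R N) :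
    ∃ (P : ModuleCat.{u} (Dorroh R)) (p : P →ₗ[Dorroh R] N),
      IsUnitary R P ∧ Module.Projective (Dorroh R) P ∧ Function.Surjective p := by
  classical
  -- Indexing by the range of `e` instead of `I` keeps the direct sum in `Type u`, whatever the
  -- universe of `I`.
  let e' : Set.range e → R := Subtype.val
  have h' : ∀ x, e' x * e' x = e' x := by rintro ⟨_, i, rfl⟩; exact he.idem i
  let F : Set.range e × N → Type u := fun k => projMod e' k.1
  let p : (⨁ k, F k) →ₗ[Dorroh R] N := DirectSum.toModule _ _ _ fun k => projHom e' k.1 k.2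
  have : ∀ k, Module.Projective (Dorroh R) (F k) := fun k => projective_projMod (h' k.1)
  refine ⟨ModuleCat.of _ (⨁ k, F k), p, IsUnitary.directSum fun k => isUnitary_projMod (h' k.1),
    inferInstanceAs (Module.Projective (Dorroh R) (Π₀ k, F k)), ?_⟩
  rw [← LinearMap.range_eq_top, eq_top_iff]
  rintro n -
  obtain ⟨s, hs⟩ := IsUnitary.exists_unit he hN n
  rw [← hs s subset_rfl]
  refine sum_mem fun i _ => ⟨DirectSum.lof (Dorroh R) _ F (⟨e i, i, rfl⟩, n)
    (projGen (h' ⟨e i, i, rfl⟩)), ?_⟩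
  change DirectSum.toModule _ _ _ _ _ = _
  rw [DirectSum.toModule_lof]
  rfl

/-- A projective object of Mod(R) is a direct summand of a cover by modules `R e_i`, and these are
projective over `Dorroh R`. -/
theorem IsWEI.isProj_iff (he : IsWEI e) (P : ModuleCat.{u} (Dorroh R)) :
    IsProj P ↔ IsUnitary R P ∧ Module.Projective (Dorroh R) P := by
  constructor
  · rintro ⟨h1, h2⟩
    refine ⟨h1, ?_⟩
    obtain ⟨F, p, hF, hF', hp⟩ := he.exists_cover P h1
    obtain ⟨s, hs⟩ := h2 F P hF h1 p LinearMap.id hp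
    exact Module.Projective.of_split s p hs
  · rintro ⟨h1, h2⟩
    exact ⟨h1, fun X Y _ _ g f hg => Module.projective_lifting_property g f hg⟩

/-- The projective dimension of a unitary module in `Mod(R)` is its projective dimension over
`Dorroh R`. -/
theorem IsWEI.hasPdLE_iff (he : IsWEI e) (n : ℕ) (N : ModuleCat.{u} (Dorroh R)) :
    HasPdLE n N ↔ IsUnitary R N ∧ HasProjectiveDimensionLE N n := by
  induction n generalizing N with
  | zero => rw [HasPdLE, he.isProj_iff, pdLE_zero_iff]
  | succ n ih =>
    rw [HasPdLE]
    constructor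
    · rintro ⟨P, p, hP, hp, hk⟩
      rw [he.isProj_iff] at hP
      refine ⟨hP.1.of_surjective p hp, ?_⟩
      exact IsSES.pdLE_right (L := ModuleCat.of _ (LinearMap.ker p)) (isSES_ker p hp)
        ((ih _).1 hk).2 (pdLE_mono (Nat.zero_le _) (pdLE_zero_iff.2 hP.2))
    · rintro ⟨hN, hd⟩
      obtain ⟨P, p, hP, hP', hp⟩ := he.exists_cover N hN
      refine ⟨P, p, (he.isProj_iff P).2 ⟨hP, hP'⟩, hp, (ih _).2
        ⟨IsUnitary.submodule he hP _, ?_⟩⟩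
      exact IsSES.pdLE_left (L := ModuleCat.of _ (LinearMap.ker p)) (isSES_ker p hp)
        (pdLE_mono (Nat.zero_le _) (pdLE_zero_iff.2 hP')) hd

theorem pd_le_coe_iff (he : IsWEI e) {N : ModuleCat.{u} (Dorroh R)} (hN : IsUnitary R N) (n : ℕ) :
    pd N ≤ n ↔ HasProjectiveDimensionLE N n := by
  constructor
  · intro h
    -- The strict inequality extracts from the infimum an actual resolution, of length at most n.
    have h' : pd N < ((n + 1 : ℕ) : ℕ∞) := lt_of_le_of_lt h (by exact_mod_cast Nat.lt_succ_self n)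
    simp only [pd, iInf_lt_iff] at h'
    obtain ⟨m, hm, hmn⟩ := h'
    have : m ≤ n := by
      have : m < n + 1 := by exact_mod_cast hmn
      omega
    exact pdLE_mono this ((he.hasPdLE_iff m N).1 hm).2
  · intro h
    exact iInf₂_le n ((he.hasPdLE_iff n N).2 ⟨hN, h⟩)

theorem pd_lt_top_iff (he : IsWEI e) {N : ModuleCat.{u} (Dorroh R)} (hN : IsUnitary R N) :
    pd N < ⊤ ↔ ∃ n, HasProjectiveDimensionLE N n := by
  constructor
  · intro h
    obtain ⟨n, hn⟩ := ENat.ne_top_iff_exists.1 h.ne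
    exact ⟨n, (pd_le_coe_iff he hN n).1 hn.ge⟩
  · rintro ⟨n, hn⟩
    exact lt_of_le_of_lt ((pd_le_coe_iff he hN n).2 hn) (ENat.natCast_lt_top n)

end ProjMod

end Unitary

/-! ### Filtered modules -/

section Filtration

variable {R : Type u} [NonUnitalRing R] {Θ : ModClass R}

/-- The submodule `b` of `N` is the top of a finite chain of submodules starting at `0` with
factors in `Θ`. -/
inductive IsFiltered (Θ : ModClass R) {N : ModuleCat.{u} (Dorroh R)} :
    Submodule (Dorroh R) N → Prop
  | bot : IsFiltered Θ ⊥
  | step {a b : Submodule (Dorroh R) N} {X : ModuleCat.{u} (Dorroh R)} (g : b →ₗ[Dorroh R] X) :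
      IsFiltered Θ a → a ≤ b → Θ X → Function.Surjective g → (∀ x : b, g x = 0 ↔ (x : N) ∈ a) →
      IsFiltered Θ b

/-- The inductive form supports induction on the length of the chain and records each factor as a
surjection with prescribed kernel, which avoids quotients of submodules by submodules. -/
theorem filt_iff {N : ModuleCat.{u} (Dorroh R)} :
    Filt Θ N ↔ IsUnitary R N ∧ IsFiltered Θ (⊤ : Submodule (Dorroh R) N) := by
  refine and_congr_right fun _ => ⟨?_, ?_⟩
  · rintro ⟨n, c, h0, hn, hc⟩
    suffices h : ∀ k, k ≤ n → IsFiltered Θ (c k) from hn ▸ h n le_rfl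
    intro k
    induction k with
    | zero => intro _; rw [h0]; exact IsFiltered.bot
    | succ k ih =>
      intro hk
      obtain ⟨hle, X, hX, ⟨φ⟩⟩ := hc k hk
      refine IsFiltered.step (φ.toLinearMap.comp (Submodule.mkQ _)) (ih (by omega)) hle hX
        (φ.surjective.comp (Submodule.mkQ_surjective _)) fun x => ?_
      simp only [LinearMap.comp_apply, LinearEquiv.coe_coe, LinearEquiv.map_eq_zero_iff,
        Submodule.mkQ_apply, Submodule.Quotient.mk_eq_zero]
      exact Iff.rfl
  · generalize (⊤ : Submodule (Dorroh R) N) = b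
    intro h
    induction h with
    | bot => exact ⟨0, fun _ => ⊥, rfl, rfl, by simp⟩
    | @step a b X g _ hle hX hg hg' ih =>
      obtain ⟨n, c, h0, hn, hc⟩ := ih
      refine ⟨n + 1, fun k => if k ≤ n then c k else b, by simpa using h0, by simp,
        fun k hk => ?_⟩
      beta_reduce
      rcases Nat.lt_succ_iff_lt_or_eq.1 hk with hk | rfl
      · rw [if_pos hk.le, if_pos (Nat.succ_le_of_lt hk)]
        exact hc k hk
      · rw [if_pos le_rfl, if_neg (Nat.not_succ_le_self k), hn]
        refine ⟨hle, X, hX, ⟨(Submodule.quotEquivOfEq _ _ ?_).trans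
          (g.quotKerEquivOfSurjective hg)⟩⟩
        ext x
        rw [LinearMap.mem_ker, hg']
        exact Iff.rfl

theorem IsFiltered.map {L N : ModuleCat.{u} (Dorroh R)} {i : L →ₗ[Dorroh R] N}
    (hi : Function.Injective i) {b : Submodule (Dorroh R) L} (hb : IsFiltered Θ b) :
    IsFiltered Θ (b.map i) := by
  induction hb with
  | bot => rw [Submodule.map_bot]; exact IsFiltered.bot
  | @step a b X g _ hle hX hg hg' ih =>
    refine IsFiltered.step (g.comp (Submodule.equivMapOfInjective i hi b).symm.toLinearMap) ih
      (Submodule.map_mono hle) hX (hg.comp (LinearEquiv.surjective _)) fun x => ?_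
    obtain ⟨y, rfl⟩ := (Submodule.equivMapOfInjective i hi b).surjective x
    simp only [LinearMap.comp_apply, LinearEquiv.coe_coe, LinearEquiv.symm_apply_apply, hg',
      Submodule.coe_equivMapOfInjective_apply, Submodule.mem_map]
    exact ⟨fun h => ⟨_, h, rfl⟩, fun ⟨z, hz, h⟩ => hi h ▸ hz⟩

theorem Filt.unitary {N : ModuleCat.{u} (Dorroh R)} (h : Filt Θ N) : IsUnitary R N := h.1

theorem Filt.step {L N X D : ModuleCat.{u} (Dorroh R)} {i : L →ₗ[Dorroh R] N}
    {g : N →ₗ[Dorroh R] D} (h : IsSES i g) (hN : IsUnitary R N) (hL : Filt Θ L) (φ : D ≃ₗ[Dorroh R] X)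
    (hX : Θ X) : Filt Θ N := by
  refine filt_iff.2 ⟨hN, IsFiltered.step ((φ.toLinearMap.comp g).comp (⊤ : Submodule _ N).subtype)
    ((filt_iff.1 hL).2.map h.inj) le_top hX ?_ fun x => ?_⟩
  · exact (φ.surjective.comp h.surj).comp fun x => ⟨⟨x, trivial⟩, rfl⟩
  · simp [h.exact]

theorem Filt.of_equiv {L N : ModuleCat.{u} (Dorroh R)} (hL : Filt Θ L) (φ : L ≃ₗ[Dorroh R] N) :
    Filt Θ N := by
  refine filt_iff.2 ⟨hL.unitary.of_surjective φ.toLinearMap φ.surjective, ?_⟩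
  have := (filt_iff.1 hL).2.map (N := N) (i := φ.toLinearMap) φ.injective
  rwa [Submodule.map_top, LinearMap.range_eq_top.2 φ.surjective] at this

theorem Filt.of_subsingleton (N : ModuleCat.{u} (Dorroh R)) [Subsingleton N] : Filt Θ N := by
  refine filt_iff.2 ⟨?_, ?_⟩
  · rw [IsUnitary, eq_top_iff]
    rintro x -
    rw [Subsingleton.elim x 0]
    exact zero_mem _
  · rw [Subsingleton.elim (⊤ : Submodule (Dorroh R) N) ⊥]
    exact IsFiltered.bot

theorem Filt.of_mem {N X : ModuleCat.{u} (Dorroh R)} (hN : IsUnitary R N) (φ : N ≃ₗ[Dorroh R] X)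
    (hX : Θ X) : Filt Θ N := by
  have h : IsSES (L := ModuleCat.of (Dorroh R) PUnit.{u + 1}) (0 : _ →ₗ[Dorroh R] N)
      (LinearMap.id : N →ₗ[Dorroh R] N) :=
    ⟨fun _ _ _ => Subsingleton.elim (α := PUnit) _ _, Function.surjective_id, fun n => by
      simp [eq_comm]⟩
  have : Subsingleton (ModuleCat.of (Dorroh R) PUnit.{u + 1}) :=
    inferInstanceAs (Subsingleton PUnit)
  exact Filt.step h hN (Filt.of_subsingleton _) φ hX

/-! ### Induction along filtrations and closure under extensions -/

variable {I : Type v} {e : I → R} (he : IsWEI e)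
include he

/-- Peeling off the top factor turns a chain into successive short exact sequences. `P` is not
assumed invariant under isomorphism, so the induction runs over all modules isomorphic to a given
term of the chain. -/
theorem Filt.induct {P : ModuleCat.{u} (Dorroh R) → Prop}
    (h0 : ∀ N : ModuleCat.{u} (Dorroh R), Subsingleton N → P N)
    (hs : ∀ (L N X : ModuleCat.{u} (Dorroh R)) (i : L →ₗ[Dorroh R] N) (g : N →ₗ[Dorroh R] X),
      IsSES i g → IsUnitary R N → P L → Θ X → P N)
    {N : ModuleCat.{u} (Dorroh R)} (hN : Filt Θ N) : P N := by
  obtain ⟨hu, hf⟩ := filt_iff.1 hN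
  suffices h : ∀ b : Submodule (Dorroh R) N, IsFiltered Θ b →
      ∀ (N' : ModuleCat.{u} (Dorroh R)), (N' ≃ₗ[Dorroh R] b) → P N' from
    h ⊤ hf N Submodule.topEquiv.symm
  intro b hb
  induction hb with
  | bot => exact fun N' φ => h0 N' φ.toEquiv.subsingleton
  | @step a b X g _ hle hX hg hg' ih =>
    intro N' φ
    refine hs (ModuleCat.of (Dorroh R) a) N' X
      (φ.symm.toLinearMap.comp (Submodule.inclusion hle)) (g.comp φ.toLinearMap)
      ⟨φ.symm.injective.comp (Submodule.inclusion_injective hle), hg.comp φ.surjective,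
        fun n => ?_⟩ ?_ (ih _ (LinearEquiv.refl _ _)) hX
    · simp only [LinearMap.comp_apply, LinearEquiv.coe_coe, hg']
      constructor
      · intro h
        exact ⟨⟨_, h⟩, by rw [LinearEquiv.symm_apply_eq]; rfl⟩
      · rintro ⟨l, rfl⟩
        simp
    · exact IsUnitary.of_injective he hu (b.subtype.comp φ.toLinearMap)
        (b.subtype_injective.comp φ.injective)

theorem Filt.extension {L N X : ModuleCat.{u} (Dorroh R)} {i : L →ₗ[Dorroh R] N}
    {g : N →ₗ[Dorroh R] X} (h : IsSES i g) (hN : IsUnitary R N) (hL : Filt Θ L)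
    (hX : Filt Θ X) : Filt Θ N := by
  refine Filt.induct he (P := fun X => ∀ (N : ModuleCat.{u} (Dorroh R)) (i : L →ₗ[Dorroh R] N)
    (g : N →ₗ[Dorroh R] X), IsSES i g → IsUnitary R N → Filt Θ N) ?_ ?_ hX N i g h hN
  · intro X hX N i g h _
    exact hL.of_equiv (LinearEquiv.ofBijective i ⟨h.inj, fun n =>
      (h.exact n).1 (Subsingleton.elim _ _)⟩)
  · intro X' X D j p hjp _ ih hD N i g h hN
    -- `N'` is the preimage in `N` of the submodule `X'` of `X`. It is an extension of `X'` by `L`,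
    -- hence filtered by induction, and `N / N'` is the top factor `D`.
    let N' : Submodule (Dorroh R) N := LinearMap.ker (p.comp g)
    have hg : ∀ n : N', ∃ x, j x = g n := fun n => (hjp.exact _).1 n.2
    let g' : N' →ₗ[Dorroh R] X' := (LinearEquiv.ofInjective j hjp.inj).symm.toLinearMap.comp
      ((g.comp N'.subtype).codRestrict (LinearMap.range j) hg)
    have hg' : ∀ n : N', j (g' n) = g n := fun n =>
      congrArg Subtype.val ((LinearEquiv.ofInjective j hjp.inj).apply_symm_apply _)
    have hi : ∀ l, i l ∈ N' := fun l => by simp [N', h.comp_eq_zero]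
    refine Filt.step (L := ModuleCat.of _ N') (i := N'.subtype) (g := p.comp g)
      ⟨N'.subtype_injective, hjp.surj.comp h.surj, fun n => by simp [N']⟩ hN
      (ih (ModuleCat.of _ N') (i.codRestrict N' hi) g' ⟨fun a b hab => h.inj
        (congrArg Subtype.val hab), fun x => ?_, fun n => ?_⟩ (hN.submodule he N'))
      (LinearEquiv.refl _ _) hD
    · obtain ⟨n, hn⟩ := h.surj (j x)
      refine ⟨⟨n, ?_⟩, hjp.inj ?_⟩
      · simp [N', hn, hjp.comp_eq_zero]
      · rw [hg', hn]
    · rw [← (injective_iff_map_eq_zero' j).1 hjp.inj, hg', h.exact]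
      exact exists_congr fun l => (Subtype.ext_iff (a1 := i.codRestrict N' hi l) (a2 := n)).symm

/-- A finite bound for the factors is a bound for every extension of them, and the zero module
satisfies every bound. Conversely, each object of Θ is filtered with one factor. -/
theorem pdClass_filt (hΘ : ∀ X, Θ X → IsUnitary R X) : pdClass (Filt Θ) = pdClass Θ := by
  apply le_antisymm
  · refine iSup₂_le fun N hN => ?_
    by_cases htop : pdClass Θ = ⊤
    · rw [htop]; exact le_top
    obtain ⟨n, hn⟩ := ENat.ne_top_iff_exists.1 htop
    rw [← hn, pd_le_coe_iff he hN.unitary]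
    refine Filt.induct he (P := fun N => HasProjectiveDimensionLE N n) ?_ ?_ hN
    · intro N _
      have := Module.Free.of_subsingleton (Dorroh R) N
      exact pdLE_mono (Nat.zero_le _) (pdLE_zero_iff.2 Module.Projective.of_free)
    · intro L N X i g h _ hL hX
      refine h.pdLE_mid hL ((pd_le_coe_iff he (hΘ X hX) n).1 ?_)
      rw [hn]
      exact le_iSup₂_of_le X hX le_rfl
  · refine iSup₂_le fun X hX => ?_
    exact le_iSup₂_of_le X (Filt.of_mem (hΘ X hX) (LinearEquiv.refl _ _) hX) le_rfl

theorem IsSES.finPd_mid {L N X : ModuleCat.{u} (Dorroh R)} {i : L →ₗ[Dorroh R] N}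
    {g : N →ₗ[Dorroh R] X} (h : IsSES i g) (hN : IsUnitary R N) (hL : finPd R L)
    (hX : finPd R X) : finPd R N := by
  obtain ⟨hL, hL', n, hn⟩ := hL.imp_right (And.imp_right (pd_lt_top_iff he hL.1).1)
  obtain ⟨hX, hX', m, hm⟩ := hX.imp_right (And.imp_right (pd_lt_top_iff he hX.1).1)
  refine ⟨hN, ?_, (pd_lt_top_iff he hN).2 ⟨max n m, h.pdLE_mid (pdLE_mono (le_max_left _ _) hn)
    (pdLE_mono (le_max_right _ _) hm)⟩⟩
  have h1 : Module.Finite (Dorroh R) (LinearMap.range i) := inferInstance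
  have h2 : Module.Finite (Dorroh R) (N ⧸ LinearMap.range i) := by
    have hk : LinearMap.range i = LinearMap.ker g := by ext n; simp [h.exact]
    rw [hk]
    exact Module.Finite.equiv (g.quotKerEquivOfSurjective h.surj).symm
  exact Module.Finite.of_submodule_quotient (LinearMap.range i)

theorem finPd.of_equiv {L N : ModuleCat.{u} (Dorroh R)} (hL : finPd R L) (φ : L ≃ₗ[Dorroh R] N) :
    finPd R N := by
  have hN := hL.1.of_surjective φ.toLinearMap φ.surjective
  have := hL.2.1
  refine ⟨hN, Module.Finite.equiv φ, ?_⟩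
  obtain ⟨n, hn⟩ := (pd_lt_top_iff he hL.1).1 hL.2.2
  exact (pd_lt_top_iff he hN).2 ⟨n, pdLE_of_equiv φ hn⟩

end Filtration

/-! ### Standard modules -/

section StandardModules

variable {R : Type u} [NonUnitalRing R] {I : Type v} {e : I → R} {ι : Type w}

/-- The union of the blocks below `a`. -/
def lowerIdx [LT ι] (A : ι → Set I) (a : ι) : Set I := {r | ∃ b, b < a ∧ r ∈ A b}

variable (e) in
/-- The submodule of `N` generated by all `e_r N` with `r ∈ S`. -/
noncomputable def idemSpan (S : Set I) (N : Type*) [AddCommGroup N] [Module (Dorroh R) N] :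
    Submodule (Dorroh R) N :=
  Submodule.span (Dorroh R) {x | ∃ r ∈ S, ∃ n : N, x = toD (e r) • n}

/-- A homomorphism from `R e_r` is determined by the image of its generator, which can be any
element of `e_r N`. The trace is therefore generated by idempotents, and later arguments only have
to handle elements `e_r n`. -/
theorem traceMod_lowerProj [LT ι] (he : ∀ i, e i * e i = e i) (A : ι → Set I) (a : ι)
    (N : Type*) [AddCommGroup N] [Module (Dorroh R) N] :
    traceMod (lowerProj e A a) N = idemSpan e (lowerIdx A a) N := by
  classical
  apply le_antisymm
  · refine iSup_le fun φ => ?_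
    rintro _ ⟨x, rfl⟩
    induction x using DirectSum.induction_on with
    | zero => rw [map_zero]; exact zero_mem _
    | add x y hx hy => rw [map_add]; exact add_mem hx hy
    | of b x =>
      induction x using DirectSum.induction_on with
      | zero => rw [map_zero, map_zero]; exact zero_mem _
      | add x y hx hy => rw [map_add, map_add]; exact add_mem hx hy
      | of r x =>
        let ψ : projMod e r.1 →ₗ[Dorroh R] N := φ ∘ₗ
          DirectSum.lof (Dorroh R) _ (fun j : {j : ι // j < a} => ⨁ r : A j.1, projMod e r.1) b ∘ₗ
          DirectSum.lof (Dorroh R) _ (fun r : A b.1 => projMod e r.1) r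
        change ψ x ∈ _
        have h : projGen (he r.1) = toD (e r.1) • projGen (he r.1) :=
          Subtype.ext (by simp [coe_projGen, ← toD_mul, he])
        rw [projMod_eq_smul (he r.1) x, h, map_smul, map_smul]
        exact Submodule.smul_mem _ _ (Submodule.subset_span ⟨r.1, ⟨b.1, b.2, r.2⟩, _, rfl⟩)
  · refine Submodule.span_le.2 ?_
    rintro _ ⟨r, ⟨b, hb, hr⟩, n, rfl⟩
    let φ : lowerProj e A a →ₗ[Dorroh R] N := projHom e r n ∘ₗ
      DirectSum.component (Dorroh R) _ (fun r : A b => projMod e r.1) ⟨r, hr⟩ ∘ₗ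
      DirectSum.component (Dorroh R) _ (fun j : {j : ι // j < a} => ⨁ r : A j.1, projMod e r.1)
        ⟨b, hb⟩
    refine Submodule.mem_iSup_of_mem φ ⟨DirectSum.lof (Dorroh R) _ _ ⟨b, hb⟩
      (DirectSum.lof (Dorroh R) _ _ ⟨r, hr⟩ (projGen (he r))), ?_⟩
    simp only [φ, LinearMap.comp_apply]
    rw [DirectSum.component.lof_self, DirectSum.component.lof_self, projHom_gen]

theorem stdTrace_eq [LT ι] (he : ∀ i, e i * e i = e i) (A : ι → Set I) (a : ι) (t : I) :
    stdTrace e A a t = idemSpan e (lowerIdx A a) (projMod e t) :=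
  traceMod_lowerProj he A a _

theorem smul_mem_stdTrace [LT ι] (he : ∀ i, e i * e i = e i) {A : ι → Set I} {a : ι} {t r : I}
    (hr : r ∈ lowerIdx A a) (x : projMod e t) : toD (e r) • x ∈ stdTrace e A a t := by
  rw [stdTrace_eq he]
  exact Submodule.subset_span ⟨r, hr, x, rfl⟩

variable (e) in
/-- The projection `R e_t → Δ_t(a)`. -/
noncomputable def stdMk [LT ι] (A : ι → Set I) (a : ι) (t : I) :
    projMod e t →ₗ[Dorroh R] stdMod e A a t :=
  (stdTrace e A a t).mkQ

theorem stdMk_surjective [LT ι] (A : ι → Set I) (a : ι) (t : I) :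
    Function.Surjective (stdMk e A a t) := Submodule.mkQ_surjective _

theorem stdMk_eq_zero_iff [LT ι] {A : ι → Set I} {a : ι} {t : I} {x : projMod e t} :
    stdMk e A a t x = 0 ↔ x ∈ stdTrace e A a t := Submodule.Quotient.mk_eq_zero _

theorem isUnitary_stdMod [LT ι] (he : ∀ i, e i * e i = e i) (A : ι → Set I) (a : ι) (t : I) :
    IsUnitary R (stdMod e A a t) :=
  (isUnitary_projMod (he t)).of_surjective (stdMk e A a t) (stdMk_surjective A a t)

theorem stdClass_unitary [LT ι] (he : ∀ i, e i * e i = e i) {A : ι → Set I} {S : Set ι}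
    {X : ModuleCat.{u} (Dorroh R)} (hX : stdClassOn e A S X) : IsUnitary R X := by
  obtain ⟨a, _, t, _, rfl⟩ := hX
  exact isUnitary_stdMod he A a t

theorem finDim_eq_of_filt_eq (he : IsWEI e) [LT ι] {A : ι → Set I}
    (h : Filt (stdClass e A) = finPd R) : finDim R = pdClass (stdClass e A) := by
  rw [finDim, ← h, pdClass_filt he (Θ := stdClass e A) fun X hX => stdClass_unitary he.idem hX]

/-- The factors of the given chain may come in any order, so L is built along the chain. Let the top
factor be Δ_t(c). If a ≤ c, the idempotents below a kill it and L does not change. If c < a, the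
submodule `R e_t n₀` generated by a lift of the generator is added; since Tr_c(Re_t) is sent into
the old L, exactly one new factor Δ_t(c) appears. -/
theorem exists_lower_filt [LinearOrder ι] (he : IsWEI e) {A : ι → Set I} (a : ι)
    {N : ModuleCat.{u} (Dorroh R)} (hN : Filt (stdClass e A) N) :
    ∃ L : Submodule (Dorroh R) N, Filt (stdClassOn e A {j | j < a}) (ModuleCat.of (Dorroh R) L) ∧
      ∀ r ∈ lowerIdx A a, ∀ n : N, toD (e r) • n ∈ L := by
  refine Filt.induct he (P := fun N => ∃ L : Submodule (Dorroh R) N,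
    Filt (stdClassOn e A {j | j < a}) (ModuleCat.of (Dorroh R) L) ∧
      ∀ r ∈ lowerIdx A a, ∀ n : N, toD (e r) • n ∈ L) ?_ ?_ hN
  · intro N _
    exact ⟨⊥, Filt.of_subsingleton _, fun r _ n => Subsingleton.elim _ _⟩
  rintro N₁ N X i g h hN ⟨L₁, hL₁, hL₁'⟩ ⟨c, -, t, ht, rfl⟩
  have hM : Filt (stdClassOn e A {j | j < a}) (ModuleCat.of (Dorroh R) (L₁.map i)) :=
    hL₁.of_equiv (Submodule.equivMapOfInjective i h.inj L₁)
  -- If `e_r w` comes from some l in `N₁`, it also comes from `e_r l`, which lies in `L₁`.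
  have hlow : ∀ r ∈ lowerIdx A a, ∀ w : N, g (toD (e r) • w) = 0 → toD (e r) • w ∈ L₁.map i := by
    intro r hr w hw
    obtain ⟨l, hl⟩ := (h.exact _).1 hw
    exact ⟨toD (e r) • l, hL₁' r hr l, by rw [map_smul, hl, he.smul_self]⟩
  have hmk : ∀ x : N, ∃ y : projMod e t, g x = stdMk e A c t y := fun x => by
    obtain ⟨y, hy⟩ := stdMk_surjective A c t (g x)
    exact ⟨y, hy.symm⟩
  have hzero : ∀ r ∈ lowerIdx A c, ∀ x : N, g (toD (e r) • x) = 0 := by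
    intro r hr x
    obtain ⟨y, hy⟩ := hmk x
    rw [map_smul, hy, ← map_smul]
    exact stdMk_eq_zero_iff.2 (smul_mem_stdTrace he.idem hr y)
  rcases le_or_gt a c with hac | hca
  · exact ⟨L₁.map i, hM, fun r hr n => hlow r hr n (hzero r
      (hr.imp fun b hb => ⟨hb.1.trans_le hac, hb.2⟩) n)⟩
  · have hsub : ∀ r, r ∈ lowerIdx A c → r ∈ lowerIdx A a := fun r hr =>
      hr.imp fun b hb => ⟨hb.1.trans hca, hb.2⟩
    obtain ⟨n₀, hn₀⟩ := h.surj (stdMk e A c t (projGen (he.idem t)))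
    have hgp : ∀ y : projMod e t, g (projHom e t n₀ y) = stdMk e A c t y := fun y => by
      rw [projHom_apply, map_smul, hn₀]
      conv_rhs => rw [projMod_eq_smul (he.idem t) y, map_smul]
    have htr : stdTrace e A c t ≤ (L₁.map i).comap (projHom e t n₀) := by
      rw [stdTrace_eq he.idem]
      refine Submodule.span_le.2 ?_
      rintro _ ⟨r, hr, z, rfl⟩
      change projHom e t n₀ (toD (e r) • z) ∈ L₁.map i
      rw [map_smul]
      exact hlow r (hsub r hr) _ (hzero r hr _)
    refine ⟨L₁.map i ⊔ LinearMap.range (projHom e t n₀), ?_, fun r hr n => ?_⟩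
    · refine Filt.step (L := ModuleCat.of _ (L₁.map i)) (D := stdMod e A c t)
        (X := stdMod e A c t) (i := Submodule.inclusion le_sup_left)
        (g := g.comp (Submodule.subtype _))
        ⟨Submodule.inclusion_injective _, fun x => ?_, fun n => ?_⟩ (hN.submodule he _) hM
        (LinearEquiv.refl _ _) ⟨c, hca, t, ht, rfl⟩
      · obtain ⟨y, rfl⟩ := stdMk_surjective A c t x
        exact ⟨⟨projHom e t n₀ y, Submodule.mem_sup_right ⟨y, rfl⟩⟩, hgp y⟩
      · constructor
        · intro hn
          obtain ⟨n, hn'⟩ := n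
          obtain ⟨_, ⟨m, hm, rfl⟩, _, ⟨y, rfl⟩, rfl⟩ := Submodule.mem_sup.1 hn'
          change g (i m + projHom e t n₀ y) = 0 at hn
          rw [map_add, h.comp_eq_zero, zero_add, hgp] at hn
          have hy := htr (stdMk_eq_zero_iff.1 hn)
          exact ⟨⟨i m + projHom e t n₀ y, add_mem ⟨m, hm, rfl⟩ hy⟩, rfl⟩
        · rintro ⟨⟨_, m, hm, rfl⟩, rfl⟩
          exact h.comp_eq_zero m
    · obtain ⟨y, hy⟩ := hmk n
      -- Subtracting the multiple of the lift with the same image in Δ_t(c) moves `n` into the image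
      -- of `N₁`, where the induction hypothesis applies.
      have h1 : toD (e r) • (n - projHom e t n₀ y) ∈ L₁.map i := hlow r hr _ (by
        rw [map_smul, map_sub, hgp, hy, sub_self, smul_zero])
      rw [smul_sub] at h1
      have h2 := add_mem (Submodule.mem_sup_left (T := LinearMap.range (projHom e t n₀)) h1)
        (Submodule.mem_sup_right (S := L₁.map i) (Submodule.smul_mem _ (toD (e r))
          (LinearMap.mem_range_self (projHom e t n₀) y)))
      rwa [sub_add_cancel] at h2

/-- The trace is a syzygy of a standard module. The Noetherian hypothesis makes it finitely
generated, and it inherits finite projective dimension, so it is filtered by standard modules;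
`exists_lower_filt` then cuts the filtration down to indices below a. -/
theorem isStandardlyStratified_of_filt_eq [LinearOrder ι] {K : Type*} [CommRing K] [Module K R]
    [IsScalarTower K R R] [SMulCommClass K R R] (he : IsBasic e K) {A : ι → Set I}
    (hA : IsPartition A) (hnoeth : ∀ t, IsNoetherian (Dorroh R) (projMod e t))
    (hF : Filt (stdClass e A) = finPd R) : IsStandardlyStratified e A K := by
  refine ⟨he, hA, fun a t ht => ?_⟩
  have hidem := he.wei.idem
  have hstd : Filt (stdClass e A) (stdMod e A a t) :=
    Filt.of_mem (isUnitary_stdMod hidem A a t) (LinearEquiv.refl _ _) ⟨a, trivial, t, ht, rfl⟩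
  have hTr : Filt (stdClass e A) (ModuleCat.of (Dorroh R) (stdTrace e A a t)) := by
    rw [hF] at hstd ⊢
    obtain ⟨n, hn⟩ := (pd_lt_top_iff he.wei hstd.1).1 hstd.2.2
    have hu : IsUnitary R (stdTrace e A a t) := (isUnitary_projMod (hidem t)).submodule he.wei _
    have := hnoeth t
    refine ⟨hu, inferInstanceAs (Module.Finite (Dorroh R) (stdTrace e A a t)),
      (pd_lt_top_iff he.wei hu).2 ⟨n, ?_⟩⟩
    exact IsSES.pdLE_left (L := ModuleCat.of _ (stdTrace e A a t)) (X := stdMod e A a t)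
      (N := ModuleCat.of _ (projMod e t)) (isSES_mkQ (stdTrace e A a t))
      (pdLE_mono (Nat.zero_le _) (pdLE_zero_iff.2 (projective_projMod (hidem t))))
      (pdLE_mono (Nat.le_succ n) hn)
  obtain ⟨L, hL, hL'⟩ := exists_lower_filt he.wei a hTr
  -- The trace is generated by elements `e_r x = e_r (e_r x)`, in which `e_r x` already lies in the
  -- trace; hence L contains them all.
  have htop : L.map (stdTrace e A a t).subtype = stdTrace e A a t := by
    apply le_antisymm (Submodule.map_subtype_le _ _)
    conv_lhs => rw [stdTrace_eq hidem]
    refine Submodule.span_le.2 ?_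
    rintro _ ⟨r, hr, x, rfl⟩
    refine ⟨toD (e r) • ⟨toD (e r) • x, smul_mem_stdTrace hidem hr x⟩, hL' r hr _, ?_⟩
    exact he.wei.smul_self r x
  refine hL.of_equiv ((Submodule.equivMapOfInjective (stdTrace e A a t).subtype
    (Submodule.subtype_injective _) L).trans (LinearEquiv.ofEq _ _ htop))

end StandardModules

/-! ### Finiteness conditions -/

section Finiteness

variable {R : Type u} [NonUnitalRing R] {I : Type v} {e : I → R}
variable {K : Type*} [CommRing K] [Module K R] [IsScalarTower K R R] [SMulCommClass K R R]

theorem mem_supp_projMod {i j : I} :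
    j ∈ supp e (projMod e i) ↔ ∃ r, e j * (r * e i) ≠ 0 := by
  constructor
  · rintro ⟨⟨_, r, rfl⟩, h⟩
    exact ⟨r, fun h0 => h (Subtype.ext (by simp [← toD_mul, h0]))⟩
  · rintro ⟨r, h⟩
    refine ⟨⟨toD (r * e i), r, rfl⟩, fun h0 => h (toD_injective ?_)⟩
    simpa [← toD_mul] using congrArg Subtype.val h0

/-- `R e_i` is the sum of the `e_j R e_i` over the finite support, so it is a Noetherian `K`-module.
Its `R`-submodules are `K`-submodules, which gives a strictly monotone map of lattices. -/
theorem isNoetherian_projMod (he : IsWEI e) (hfin : ∀ j i, IsFiniteLength K (corner e K j i))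
    (hs : IsLeftSupportFinite e) (i : I) : IsNoetherian (Dorroh R) (projMod e i) := by
  classical
  have : Finite (supp e (projMod e i)) := hs i
  have hN : ∀ j : supp e (projMod e i), IsNoetherian K (corner e K j.1 i) := fun j =>
    (isFiniteLength_iff_isNoetherian_isArtinian.1 (hfin j i)).1
  let W : Submodule K R := ⨆ j : supp e (projMod e i), corner e K j.1 i
  have hW : ∀ r : R, r * e i ∈ W := fun r => by
    obtain ⟨s, hs⟩ := IsUnitary.exists_unit he (isUnitary_projMod (he.idem i))
      (⟨toD (r * e i), r, rfl⟩ : projMod e i)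
    have h1 : ∑ j ∈ s, e j * (r * e i) = r * e i := by
      apply toD_injective
      have := congrArg (fun x : projMod e i => (x : Dorroh R)) (hs s subset_rfl)
      simp only [AddSubmonoidClass.coe_finsetSum, Submodule.coe_smul, smul_eq_mul,
        ← toD_mul] at this
      rw [← this]
      exact map_sum (⟨⟨toD, toD_zero⟩, toD_add⟩ : R →+ Dorroh R) _ _
    rw [← h1]
    refine sum_mem fun j _ => ?_
    by_cases hj : j ∈ supp e (projMod e i)
    · exact Submodule.mem_iSup_of_mem ⟨j, hj⟩ ⟨r, rfl⟩
    · rw [mem_supp_projMod] at hj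
      push Not at hj
      rw [hj r]
      exact zero_mem _
  let Φ : Submodule (Dorroh R) (projMod e i) → Submodule K W := fun L =>
    { carrier := {w | ∃ x ∈ L, (x : Dorroh R) = toD w.1}
      zero_mem' := ⟨0, zero_mem _, by simp⟩
      add_mem' := by
        rintro _ _ ⟨x, hx, hx'⟩ ⟨y, hy, hy'⟩
        exact ⟨x + y, add_mem hx hy, by simp [hx', hy']⟩
      -- The ring `Dorroh R` does not contain `K`. The scalar k acts on x as the sum of the `k •
      -- e_j` over a local unit for x.
      smul_mem' := by
        rintro k w ⟨x, hx, hx'⟩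
        obtain ⟨s, hs⟩ := IsUnitary.exists_unit he (isUnitary_projMod (he.idem i)) x
        refine ⟨∑ j ∈ s, toD (k • e j) • x, sum_mem fun j _ => L.smul_mem _ hx, ?_⟩
        have h1 : ∑ j ∈ s, e j * w.1 = w.1 := by
          apply toD_injective
          have := congrArg (fun x : projMod e i => (x : Dorroh R)) (hs s subset_rfl)
          simp only [AddSubmonoidClass.coe_finsetSum, Submodule.coe_smul, smul_eq_mul,
            hx', ← toD_mul] at this
          rw [← this]
          exact map_sum (⟨⟨toD, toD_zero⟩, toD_add⟩ : R →+ Dorroh R) _ _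
        simp only [AddSubmonoidClass.coe_finsetSum, Submodule.coe_smul, smul_eq_mul, hx',
          ← toD_mul, smul_mul_assoc]
        conv_rhs => rw [← h1, Finset.smul_sum]
        exact (map_sum (⟨⟨toD, toD_zero⟩, toD_add⟩ : R →+ Dorroh R) _ _).symm }
  have hΦ : StrictMono Φ := by
    refine Monotone.strictMono_of_injective (fun L L' h w ⟨x, hx, hx'⟩ => ⟨x, h hx, hx'⟩) ?_
    have key : ∀ L (x : projMod e i) (w : W), (x : Dorroh R) = toD w.1 → (x ∈ L ↔ w ∈ Φ L) := by
      intro L x w hxw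
      refine ⟨fun hx => ⟨x, hx, hxw⟩, ?_⟩
      rintro ⟨y, hy, hyw⟩
      rwa [Subtype.ext (hxw.trans hyw.symm)]
    intro L L' h
    ext x
    obtain ⟨r, hr⟩ := x.2
    rw [key L x ⟨r * e i, hW r⟩ hr, key L' x ⟨r * e i, hW r⟩ hr, h]
  have hWN : IsNoetherian K W := isNoetherian_iSup
  have := isNoetherian_iff'.1 hWN
  exact isNoetherian_iff'.2 hΦ.wellFoundedGT

/-- By local units, a finitely generated unitary module is a finite sum of images of modules `R
e_i`. -/
theorem IsWEI.isNoetherian (he : IsWEI e)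
    (hnoeth : ∀ i, IsNoetherian (Dorroh R) (projMod e i)) {N : Type*} [AddCommGroup N]
    [Module (Dorroh R) N] (hN : IsUnitary R N) (hf : Module.Finite (Dorroh R) N) :
    IsNoetherian (Dorroh R) N := by
  classical
  obtain ⟨s, hs⟩ := hf.fg_top
  choose t ht using IsUnitary.exists_unit he hN
  let F : s × (s.biUnion t) → Submodule (Dorroh R) N := fun k =>
    LinearMap.range (projHom e k.2.1 k.1.1)
  have hF : ∀ k, IsNoetherian (Dorroh R) (F k) := fun k =>
    isNoetherian_of_surjective (projHom e k.2.1 k.1.1).rangeRestrict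
      (LinearMap.range_rangeRestrict _)
  have htop : ⨆ k, F k = ⊤ := by
    rw [eq_top_iff, ← hs, Submodule.span_le]
    intro n hn
    have h := ht n (s.biUnion t) (Finset.subset_biUnion_of_mem t hn)
    change n ∈ _
    rw [← h]
    refine sum_mem fun i hi => Submodule.mem_iSup_of_mem (⟨n, hn⟩, ⟨i, hi⟩)
      ⟨projGen (he.idem i), rfl⟩
  have : IsNoetherian (Dorroh R) (⨆ k, F k : Submodule (Dorroh R) N) := isNoetherian_iSup
  rw [htop] at this
  exact isNoetherian_of_linearEquiv Submodule.topEquiv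

theorem isLeftLocallyEndofinite (he : ∀ i, e i * e i = e i)
    (hfin : ∀ j i, IsFiniteLength K (corner e K j i)) : IsLeftLocallyEndofinite e := by
  intro i j
  let E := Module.End (Dorroh R) (projMod e i)
  let Φ : Submodule E (endoPart e (projMod e i) j) → Submodule K (corner e K j i) := fun L =>
    { carrier := {w | ∃ x ∈ L, ((x : projMod e i) : Dorroh R) = toD w.1}
      zero_mem' := ⟨0, zero_mem _, by simp⟩
      add_mem' := by
        rintro _ _ ⟨x, hx, hx'⟩ ⟨y, hy, hy'⟩
        exact ⟨x + y, add_mem hx hy, by simp [hx', hy']⟩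
      smul_mem' := by
        rintro k ⟨_, r, rfl⟩ ⟨x, hx, hx'⟩
        -- Right multiplication by `k • e i` is an endomorphism of `R e_i` that acts as the scalar
        -- k. Hence every submodule over the endomorphism ring is a `K`-submodule.
        let ψ : E := projHom e i (⟨toD (k • e i * e i), k • e i, rfl⟩ : projMod e i)
        refine ⟨ψ • x, L.smul_mem _ hx, ?_⟩
        change ((x : projMod e i) : Dorroh R) * toD (k • e i * e i) = toD (k • (e j * (r * e i)))
        rw [hx']
        change toD (e j * (r * e i)) * _ = _
        rw [← toD_mul, smul_mul_assoc, he, mul_smul_comm, mul_assoc, mul_assoc, he] }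
  have hΦ : StrictMono Φ := by
    refine Monotone.strictMono_of_injective (fun L L' h w ⟨x, hx, hx'⟩ => ⟨x, h hx, hx'⟩) ?_
    have key : ∀ L (x : endoPart e (projMod e i) j) (w : corner e K j i),
        ((x : projMod e i) : Dorroh R) = toD w.1 → (x ∈ L ↔ w ∈ Φ L) := by
      intro L x w hxw
      refine ⟨fun hx => ⟨x, hx, hxw⟩, ?_⟩
      rintro ⟨y, hy, hyw⟩
      rwa [Subtype.ext (Subtype.ext (hxw.trans hyw.symm))]
    intro L L' h
    ext x
    obtain ⟨⟨y, r, hy⟩, hr⟩ := x.2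
    have hx : ((x : projMod e i) : Dorroh R) = toD (e j * (r * e i)) := by
      rw [hr, toD_mul, ← hy]; rfl
    rw [key L x ⟨_, r, rfl⟩ hx, key L' x ⟨_, r, rfl⟩ hx, h]
  obtain ⟨h1, h2⟩ := isFiniteLength_iff_isNoetherian_isArtinian.1 (hfin j i)
  have h1' := isNoetherian_iff'.1 h1
  exact isFiniteLength_iff_isNoetherian_isArtinian.2
    ⟨isNoetherian_iff'.2 hΦ.wellFoundedGT, hΦ.wellFoundedLT⟩

theorem corner_opFam (i j : I) : corner (opFam e) K j i =
    (corner e K i j).map (MulOpposite.opLinearEquiv K : R ≃ₗ[K] Rᵐᵒᵖ).toLinearMap := by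
  ext x
  constructor
  · rintro ⟨r, rfl⟩
    refine ⟨e i * (r.unop * e j), ⟨r.unop, rfl⟩, MulOpposite.unop_injective ?_⟩
    exact (mul_assoc _ _ _).symm
  · rintro ⟨_, ⟨r, rfl⟩, rfl⟩
    exact ⟨MulOpposite.op r, MulOpposite.unop_injective (mul_assoc _ _ _)⟩

theorem IsBasic.isLocallyBounded (he : IsBasic e K) (hs : IsSupportFinite e) :
    IsLocallyBounded e where
  wei := he.wei
  primitive := he.primitive
  left_endofinite := isLeftLocallyEndofinite he.wei.idem he.homFinite
  right_endofinite := isLeftLocallyEndofinite (K := K)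
    (fun i => MulOpposite.unop_injective (he.wei.idem i)) fun j i => by
      rw [corner_opFam]
      exact (he.homFinite i j).of_surjective (f := ((MulOpposite.opLinearEquiv K).submoduleMap
        (corner e K i j)).toLinearMap) (LinearEquiv.surjective _)
  supportFinite := hs

end Finiteness

/-! ### Restriction of scalars -/

section Pull

variable {R S : Type u} [NonUnitalRing R] [NonUnitalRing S] (φ : R →ₙ+* S) (ψ : S →ₙ+* R)

/-- Restriction of scalars along a homomorphism of (non-unital) rings. -/
noncomputable def pull (Y : ModuleCat.{u} (Dorroh S)) : ModuleCat.{u} (Dorroh R) :=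
  @ModuleCat.of (Dorroh R) _ Y _ (Module.compHom Y (Dorroh.map φ))

/-- The identity map. -/
noncomputable def toPull (Y : ModuleCat.{u} (Dorroh S)) : Y ≃+ pull φ Y := AddEquiv.refl Y

variable {φ ψ} {Y Y' Y'' : ModuleCat.{u} (Dorroh S)}

theorem smul_toPull (d : Dorroh R) (y : Y) : d • toPull φ Y y = toPull φ Y (Dorroh.map φ d • y) :=
  rfl

theorem toD_smul_toPull (r : R) (y : Y) : toD r • toPull φ Y y = toPull φ Y (toD (φ r) • y) := by
  rw [smul_toPull, Dorroh.map_toD]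

variable (φ) in
/-- Restriction of scalars on homomorphisms. -/
noncomputable def pullMap (f : Y →ₗ[Dorroh S] Y') : pull φ Y →ₗ[Dorroh R] pull φ Y' where
  toFun := f
  map_add' := f.map_add
  map_smul' d y := f.map_smul (Dorroh.map φ d) y

theorem pullMap_toPull (f : Y →ₗ[Dorroh S] Y') (y : Y) :
    pullMap φ f (toPull φ Y y) = toPull φ Y' (f y) := rfl

theorem IsSES.pull {i : Y →ₗ[Dorroh S] Y'} {g : Y' →ₗ[Dorroh S] Y''} (h : IsSES i g) :
    IsSES (pullMap φ i) (pullMap φ g) := ⟨h.inj, h.surj, h.exact⟩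

variable (φ) in
/-- Restriction of scalars on isomorphisms. -/
noncomputable def pullEquiv (f : Y ≃ₗ[Dorroh S] Y') : pull φ Y ≃ₗ[Dorroh R] pull φ Y' :=
  LinearEquiv.ofBijective (pullMap φ f.toLinearMap) f.bijective

/-- For surjective `φ`, the homomorphisms are the same before and after restriction. -/
noncomputable def unpullMap (hφ : Function.Surjective φ)
    (f : pull φ Y →ₗ[Dorroh R] pull φ Y') : Y →ₗ[Dorroh S] Y' where
  toFun y := (toPull φ Y').symm (f (toPull φ Y y))
  map_add' := f.map_add
  map_smul' d y := by
    obtain ⟨d, rfl⟩ := Dorroh.map_surjective hφ d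
    exact f.map_smul d y

theorem isUnitary_pull (hφ : Function.Surjective φ) (hY : IsUnitary S Y) :
    IsUnitary R (pull φ Y) := by
  refine (AddSubgroup.eq_top_iff' _).2 fun y => ?_
  have hn : (toPull φ Y).symm y ∈ AddSubgroup.closure {x : Y | ∃ (r : S) (m : Y), x = toD r • m} := by
    rw [hY]; trivial
  have key : ∀ y : Y, y ∈ AddSubgroup.closure {x : Y | ∃ (r : S) (m : Y), x = toD r • m} →
      toPull φ Y y ∈ AddSubgroup.closure
        {x : pull φ Y | ∃ (r : R) (m : pull φ Y), x = toD r • m} := by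
    intro y hy
    induction hy using AddSubgroup.closure_induction with
    | mem x hx =>
      obtain ⟨r, m, rfl⟩ := hx
      obtain ⟨r, rfl⟩ := hφ r
      exact AddSubgroup.subset_closure ⟨r, toPull φ Y m, (toD_smul_toPull r m).symm⟩
    | zero => rw [map_zero]; exact zero_mem _
    | add x y _ _ hx hy => rw [map_add]; exact add_mem hx hy
    | neg x _ hx => rw [map_neg]; exact neg_mem hx
  exact key _ hn

theorem finite_pull_iff (hφ : Function.Surjective φ) :
    Module.Finite (Dorroh R) (pull φ Y) ↔ Module.Finite (Dorroh S) Y := by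
  have hs : RingHomSurjective (Dorroh.map φ) := ⟨Dorroh.map_surjective hφ⟩
  constructor
  · intro h
    let f : pull φ Y →ₛₗ[Dorroh.map φ] Y :=
      { (toPull φ Y).symm with map_smul' := fun d y => rfl }
    exact Module.Finite.of_surjective f (toPull φ Y).symm.surjective
  · rintro ⟨s, hs⟩
    refine ⟨⟨s, (Submodule.eq_top_iff').2 fun y => ?_⟩⟩
    have hy : (toPull φ Y).symm y ∈ Submodule.span (Dorroh S) (s : Set Y) := by rw [hs]; trivial
    have key : ∀ y : Y, y ∈ Submodule.span (Dorroh S) (s : Set Y) →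
        toPull φ Y y ∈ Submodule.span (Dorroh R) ((↑(show Finset (pull φ Y) from s)) : Set (pull φ Y)) := by
      intro y hy
      induction hy using Submodule.span_induction with
      | mem x hx => exact Submodule.subset_span hx
      | zero => rw [map_zero]; exact zero_mem _
      | add x y _ _ hx hy => rw [map_add]; exact add_mem hx hy
      | smul d x _ hx =>
        obtain ⟨d, rfl⟩ := Dorroh.map_surjective hφ d
        exact Submodule.smul_mem _ d hx
    exact key _ hy

/-- Restricting along `φ` and then along a section of `φ` changes nothing. -/
noncomputable def pullSection (h : ∀ s, φ (ψ s) = s) : pull ψ (pull φ Y) ≃ₗ[Dorroh S] Y :=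
  LinearEquiv.ofBijective
    (linOfToD ((toPull φ Y).symm.toAddMonoidHom.comp (toPull ψ (pull φ Y)).symm.toAddMonoidHom)
      fun s y => by
        obtain ⟨y, rfl⟩ := (toPull ψ (pull φ Y)).surjective y
        obtain ⟨y, rfl⟩ := (toPull φ Y).surjective y
        simp [toD_smul_toPull, h])
    ((toPull φ Y).symm.bijective.comp (toPull ψ (pull φ Y)).symm.bijective)

/-- A module on which `R` acts through `φ` is recovered from its restriction along a section. -/
noncomputable def pullRetraction {N : ModuleCat.{u} (Dorroh R)}
    (h : ∀ r, ∀ n : N, toD (ψ (φ r)) • n = toD r • n) : pull φ (pull ψ N) ≃ₗ[Dorroh R] N :=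
  LinearEquiv.ofBijective
    (linOfToD ((toPull ψ N).symm.toAddMonoidHom.comp (toPull φ (pull ψ N)).symm.toAddMonoidHom)
      fun s y => by
        obtain ⟨y, rfl⟩ := (toPull φ (pull ψ N)).surjective y
        obtain ⟨y, rfl⟩ := (toPull ψ N).surjective y
        simp [toD_smul_toPull, h])
    ((toPull ψ N).symm.bijective.comp (toPull φ (pull ψ N)).symm.bijective)

theorem Filt.pull {I : Type v} {e : I → S} (he : IsWEI e) (hφ : Function.Surjective φ)
    {Θ : ModClass S} {Θ' : ModClass R} (hΘ : ∀ X, Θ X → Filt Θ' (pull φ X))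
    {J : Type w} {f : J → R} (hf : IsWEI f) (hY : Filt Θ Y) : Filt Θ' (pull φ Y) := by
  refine Filt.induct he (P := fun Y => Filt Θ' (_root_.pull φ Y)) ?_ ?_ hY
  · intro N hN
    have : Subsingleton (_root_.pull φ N) := hN
    exact Filt.of_subsingleton _
  · intro L N X i g h hN hL hX
    exact Filt.extension hf h.pull (isUnitary_pull hφ hN) hL (hΘ X hX)

end Pull

/-! ### Standard modules and restriction of scalars -/

section StdPull

variable {R S : Type u} [NonUnitalRing R] [NonUnitalRing S] {φ : R →ₙ+* S}
  {I : Type*} {I' : Type*} {e : I → R} {e' : I' → S}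

/-- The homomorphism `R e_t → S e'_t` induced by `φ : R → S` with `φ (e_t) = e'_t`. -/
noncomputable def projMap {t : I} {t' : I'} (ht : φ (e t) = e' t') :
    projMod e t →ₗ[Dorroh R] pull φ (ModuleCat.of (Dorroh S) (projMod e' t')) where
  toFun x := toPull φ (ModuleCat.of (Dorroh S) (projMod e' t')) ⟨Dorroh.map φ x, by
    obtain ⟨_, r, rfl⟩ := x
    exact ⟨φ r, by rw [Dorroh.map_toD, map_mul, ht]⟩⟩
  map_add' x y := by
    rw [← map_add]
    exact congrArg _ (Subtype.ext (map_add (Dorroh.map φ) _ _))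
  map_smul' d x := by
    rw [RingHom.id_apply, smul_toPull]
    exact congrArg _ (Subtype.ext (map_mul (Dorroh.map φ) _ _))

theorem projMap_eq_zero_iff {t : I} {t' : I'} (ht : φ (e t) = e' t') (x : projMod e t) :
    projMap ht x = 0 ↔ Dorroh.map φ x = 0 := by
  refine ((toPull φ (ModuleCat.of (Dorroh S) (projMod e' t'))).map_eq_zero_iff).trans ?_
  exact Subtype.ext_iff

theorem projMap_surjective {t : I} {t' : I'} (ht : φ (e t) = e' t') (hφ : Function.Surjective φ) :
    Function.Surjective (projMap ht) := by
  intro y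
  obtain ⟨⟨_, s, rfl⟩, rfl⟩ := (toPull φ (ModuleCat.of (Dorroh S) (projMod e' t'))).surjective y
  obtain ⟨r, rfl⟩ := hφ s
  exact ⟨⟨toD (r * e t), r, rfl⟩, congrArg (toPull φ (ModuleCat.of (Dorroh S) (projMod e' t'))) (Subtype.ext
    ((Dorroh.map_toD φ _).trans (by rw [map_mul, ht])))⟩

/-- Both sides are quotients of `R e_t`, so it suffices that the trace is the kernel of the
composite to the standard module of S. The idempotents below a vanish or go to idempotents below a',
each of which is hit, and the kernel of φ on `R e_t` lies in the trace. -/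
theorem nonempty_stdMod_equiv {ι κ : Type*} [LT ι] [LT κ] {A : ι → Set I} {A' : κ → Set I'}
    (hφ : Function.Surjective φ) (he : ∀ i, e i * e i = e i) (he' : ∀ i, e' i * e' i = e' i)
    {a : ι} {a' : κ} {t : I} {t' : I'} (ht : φ (e t) = e' t')
    (h₁ : ∀ r ∈ lowerIdx A a, φ (e r) = 0 ∨ ∃ r' ∈ lowerIdx A' a', φ (e r) = e' r')
    (h₂ : ∀ r' ∈ lowerIdx A' a', ∃ r ∈ lowerIdx A a, φ (e r) = e' r')
    (hk : ∀ x : projMod e t, Dorroh.map φ x = 0 → x ∈ stdTrace e A a t) :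
    Nonempty (stdMod e A a t ≃ₗ[Dorroh R] pull φ (stdMod e' A' a' t')) := by
  let P' := ModuleCat.of (Dorroh S) (projMod e' t')
  let q : P' →ₗ[Dorroh S] stdMod e' A' a' t' := stdMk e' A' a' t'
  let p : projMod e t →ₗ[Dorroh R] pull φ (stdMod e' A' a' t') := (pullMap φ q).comp (projMap ht)
  have hp : Function.Surjective p :=
    (stdMk_surjective (e := e') A' a' t').comp (projMap_surjective ht hφ)
  have hker : stdTrace e A a t = LinearMap.ker p := by
    apply le_antisymm
    · conv_lhs => rw [stdTrace_eq he]
      refine Submodule.span_le.2 ?_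
      rintro _ ⟨r, hr, z, rfl⟩
      change p (toD (e r) • z) = 0
      rw [map_smul]
      obtain ⟨y, hy⟩ := (toPull φ P').surjective (projMap ht z)
      have hpz : p z = toPull φ (stdMod e' A' a' t') (q y) := by
        change pullMap φ q (projMap ht z) = _
        rw [← hy, pullMap_toPull]
      rw [hpz, toD_smul_toPull]
      rcases h₁ r hr with h | ⟨r', hr', h⟩
      · rw [h, toD_zero, zero_smul, map_zero]
      · rw [h, ← map_smul]
        have : q (toD (e' r') • y) = 0 := stdMk_eq_zero_iff.2 (smul_mem_stdTrace he' hr' y)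
        rw [this, map_zero]
    · intro x hx
      have hzero : ∀ x, projMap ht x = 0 → x ∈ stdTrace e A a t := fun x hx =>
        hk x ((projMap_eq_zero_iff ht x).1 hx)
      -- Generators of the trace over S lift to generators of the trace over R. Two lifts differ by
      -- an element of the kernel, which `hk` puts in the trace.
      have key : ∀ y : P', y ∈ idemSpan e' (lowerIdx A' a') P' →
          ∀ x, projMap ht x = toPull φ P' y → x ∈ stdTrace e A a t := by
        intro y hy
        induction hy using Submodule.span_induction with
        | mem y hy =>
          obtain ⟨r', hr', z, rfl⟩ := hy
          obtain ⟨r, hr, hrr⟩ := h₂ r' hr'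
          obtain ⟨z', hz'⟩ := projMap_surjective ht hφ (toPull φ P' z)
          intro x hx
          rw [← sub_add_cancel x (toD (e r) • z')]
          refine add_mem (hzero _ ?_) (smul_mem_stdTrace he hr z')
          rw [map_sub, map_smul, hx, hz', toD_smul_toPull, hrr, sub_self]
        | zero => intro x hx; exact hzero x (hx.trans (map_zero _))
        | add y₁ y₂ _ _ h1 h2 =>
          intro x hx
          obtain ⟨x₁, hx₁⟩ := projMap_surjective ht hφ (toPull φ P' y₁)
          rw [← sub_add_cancel x x₁]
          refine add_mem (h2 _ ?_) (h1 _ hx₁)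
          rw [map_sub, hx, hx₁, map_add, add_sub_cancel_left]
        | smul d y _ h =>
          intro x hx
          obtain ⟨x₁, hx₁⟩ := projMap_surjective ht hφ (toPull φ P' y)
          obtain ⟨d, rfl⟩ := Dorroh.map_surjective hφ d
          rw [← sub_add_cancel x (d • x₁)]
          refine add_mem (hzero _ ?_) (Submodule.smul_mem _ d (h _ hx₁))
          rw [map_sub, hx, (projMap ht).map_smul, hx₁, smul_toPull, sub_self]
      obtain ⟨y, hy⟩ := (toPull φ P').surjective (projMap ht x)
      refine key y ?_ x hy.symm
      rw [← traceMod_lowerProj he']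
      have h0 : pullMap φ q (projMap ht x) = 0 := hx
      rw [← hy, pullMap_toPull] at h0
      exact stdMk_eq_zero_iff.1 ((toPull φ _).map_eq_zero_iff.1 h0)
  exact ⟨(Submodule.quotEquivOfEq _ _ hker).trans (p.quotKerEquivOfSurjective hp)⟩

end StdPull

/-! ### Families of orthogonal idempotents -/

section Idempotents

variable {R S : Type u} [NonUnitalRing R] [NonUnitalRing S] {I : Type v} {e : I → R}

/-- Independence is automatic: multiplication by `e i` is the identity on the i-th summand and kills
the others. -/
theorem isWEI_of_iSup_eq_top (h : ∀ i, e i * e i = e i) (h' : ∀ i j, i ≠ j → e i * e j = 0)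
    (hr : ⨆ i, rightIdeal e i = ⊤) (hl : ⨆ i, leftIdeal e i = ⊤) : IsWEI e where
  idem := h
  ortho := h'
  right_top := hr
  left_top := hl
  right_indep := fun i => by
    rw [AddSubgroup.disjoint_def]
    rintro _ ⟨x, rfl⟩ hx
    have hle : ⨆ (j) (_ : j ≠ i), rightIdeal e j ≤ (AddMonoidHom.mulLeft (e i)).ker := by
      refine iSup₂_le fun j hj => ?_
      rintro _ ⟨y, rfl⟩
      change e i * (e j * y) = 0
      rw [← mul_assoc, h' i j hj.symm, zero_mul]
    have h0 : e i * (e i * x) = 0 := hle hx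
    rwa [← mul_assoc, h] at h0
  left_indep := fun i => by
    rw [AddSubgroup.disjoint_def]
    rintro _ ⟨x, rfl⟩ hx
    have hle : ⨆ (j) (_ : j ≠ i), leftIdeal e j ≤ (AddMonoidHom.mulRight (e i)).ker := by
      refine iSup₂_le fun j hj => ?_
      rintro _ ⟨y, rfl⟩
      change y * e j * e i = 0
      rw [mul_assoc, h' j i hj, mul_zero]
    have h0 : x * e i * e i = 0 := hle hx
    rwa [mul_assoc, h] at h0

theorem IsWEI.op (he : IsWEI e) : IsWEI (opFam e) := by
  refine isWEI_of_iSup_eq_top (fun i => congrArg MulOpposite.op (he.idem i))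
    (fun i j h => congrArg MulOpposite.op (he.ortho j i h.symm)) ?_ ?_
  · have h : ⨆ i, leftIdeal e i ≤
        (⨆ i, rightIdeal (opFam e) i).comap (MulOpposite.opAddEquiv (α := R)).toAddMonoidHom := by
      refine iSup_le fun i => ?_
      rintro _ ⟨x, rfl⟩
      exact AddSubgroup.mem_iSup_of_mem i ⟨MulOpposite.op x, rfl⟩
    rw [he.left_top] at h
    exact (AddSubgroup.eq_top_iff' _).2 fun x => h (AddSubgroup.mem_top x.unop)
  · have h : ⨆ i, rightIdeal e i ≤
        (⨆ i, leftIdeal (opFam e) i).comap (MulOpposite.opAddEquiv (α := R)).toAddMonoidHom := by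
      refine iSup_le fun i => ?_
      rintro _ ⟨x, rfl⟩
      exact AddSubgroup.mem_iSup_of_mem i ⟨MulOpposite.op x, rfl⟩
    rw [he.right_top] at h
    exact (AddSubgroup.eq_top_iff' _).2 fun x => h (AddSubgroup.mem_top x.unop)

/-- `R e_i ≃ R e_j` if and only if `e_i = a b` and `e_j = b a` for some `a ∈ e_i R e_j` and
`b ∈ e_j R e_i`. -/
theorem nonempty_projMod_equiv_iff (h : ∀ i, e i * e i = e i) (i j : I) :
    Nonempty (projMod e i ≃ₗ[Dorroh R] projMod e j) ↔
      ∃ a b : R, a * e j = a ∧ b * e i = b ∧ a * b = e i ∧ b * a = e j := by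
  constructor
  · rintro ⟨φ⟩
    have key : ∀ {i j : I} (φ : projMod e i →ₗ[Dorroh R] projMod e j), ∃ a : R, a * e j = a ∧
        (φ (projGen (h i)) : Dorroh R) = toD a := by
      intro i j φ
      obtain ⟨r, hr⟩ := (φ (projGen (h i))).2
      exact ⟨r * e j, by rw [mul_assoc, h], hr⟩
    obtain ⟨a, ha, ha'⟩ := key φ.toLinearMap
    obtain ⟨b, hb, hb'⟩ := key φ.symm.toLinearMap
    have h1 : φ.symm (φ (projGen (h i))) = toD a • φ.symm (projGen (h j)) := by
      rw [← map_smul]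
      congr 1
      refine Subtype.ext (ha'.trans ?_)
      change _ = toD a * toD (e j)
      rw [← toD_mul, ha]
    have h2 : φ (φ.symm (projGen (h j))) = toD b • φ (projGen (h i)) := by
      rw [← map_smul]
      congr 1
      refine Subtype.ext (hb'.trans ?_)
      change _ = toD b * toD (e i)
      rw [← toD_mul, hb]
    rw [LinearEquiv.symm_apply_apply] at h1
    rw [LinearEquiv.apply_symm_apply] at h2
    refine ⟨a, b, ha, hb, toD_injective ?_, toD_injective ?_⟩
    · rw [toD_mul, ← hb']
      exact (congrArg Subtype.val h1).symm
    · rw [toD_mul, ← ha']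
      exact (congrArg Subtype.val h2).symm
  · rintro ⟨a, b, ha, hb, hab, hba⟩
    refine ⟨LinearEquiv.ofLinearMap (projHom e i (⟨toD a, a, by rw [ha]⟩ : projMod e j))
      (projHom e j (⟨toD b, b, by rw [hb]⟩ : projMod e i)) ?_ ?_⟩
    · ext x
      change (x : Dorroh R) * toD b * toD a = x
      rw [mul_assoc, ← toD_mul, hba, projMod_mul (h j)]
    · ext x
      change (x : Dorroh R) * toD a * toD b = x
      rw [mul_assoc, ← toD_mul, hab, projMod_mul (h i)]

theorem isLeftSupportFinite_of_injective {J : Type w} {g : J → S} (ψ : R →ₙ+* S)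
    (hψ : Function.Injective ψ) {k : I → J} (hk : Function.Injective k) (hg : ∀ i, g (k i) = ψ (e i))
    (h : IsLeftSupportFinite g) : IsLeftSupportFinite e := fun i => by
  refine ((h (k i)).preimage hk.injOn).subset fun j hj => ?_
  obtain ⟨r, hr⟩ := mem_supp_projMod.1 hj
  refine mem_supp_projMod.2 ⟨ψ r, fun h0 => hr (hψ ?_)⟩
  rw [map_zero, ← h0, hg, hg, map_mul, map_mul]

theorem isSupportFinite_of_injective {J : Type w} {g : J → S} (ψ : R →ₙ+* S)
    (hψ : Function.Injective ψ) {k : I → J} (hk : Function.Injective k) (hg : ∀ i, g (k i) = ψ (e i))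
    (h : IsSupportFinite g) : IsSupportFinite e :=
  ⟨isLeftSupportFinite_of_injective ψ hψ hk hg h.1,
    isLeftSupportFinite_of_injective (NonUnitalRingHom.op ψ)
      (fun _ _ hab => MulOpposite.unop_injective (hψ (MulOpposite.op_injective hab))) hk
      (fun i => congrArg MulOpposite.op (hg i)) h.2⟩

end Idempotents

/-! ### The triangular matrix algebra -/

namespace TriMat

section Homs

variable (T M U : Type u) [NonUnitalRing T] [NonUnitalRing U] [AddCommGroup M]
variable [Module (Dorroh U) M] [Module (Dorroh Tᵐᵒᵖ) M] [SMulCommClass (Dorroh U) (Dorroh Tᵐᵒᵖ) M]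

/-- The projection onto the lower right entry. -/
noncomputable def projU : TriMat T M U →ₙ+* U where
  toFun := TriMat.u
  map_mul' _ _ := rfl
  map_zero' := rfl
  map_add' _ _ := rfl

/-- The projection onto the upper left entry. -/
noncomputable def projT : TriMat T M U →ₙ+* T where
  toFun := TriMat.t
  map_mul' _ _ := rfl
  map_zero' := rfl
  map_add' _ _ := rfl

/-- The inclusion of the lower right corner. -/
noncomputable def inclU : U →ₙ+* TriMat T M U where
  toFun x := ⟨0, 0, x⟩
  map_mul' _ _ := by ext <;> simp
  map_zero' := rfl
  map_add' _ _ := by ext <;> simp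

/-- The inclusion of the upper left corner. -/
noncomputable def inclT : T →ₙ+* TriMat T M U where
  toFun x := ⟨x, 0, 0⟩
  map_mul' _ _ := by ext <;> simp
  map_zero' := rfl
  map_add' _ _ := by ext <;> simp

/-- The inclusion of the lower left corner. -/
def inclM : M →+ TriMat T M U where
  toFun x := ⟨0, x, 0⟩
  map_zero' := rfl
  map_add' _ _ := by ext <;> simp

theorem projU_surjective : Function.Surjective (projU T M U) := fun x => ⟨inclU T M U x, rfl⟩

theorem projT_surjective : Function.Surjective (projT T M U) := fun x => ⟨inclT T M U x, rfl⟩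

variable {T M U}

@[simp] theorem projU_apply (x : TriMat T M U) : projU T M U x = x.u := rfl
@[simp] theorem projT_apply (x : TriMat T M U) : projT T M U x = x.t := rfl
@[simp] theorem inclU_t (x : U) : (inclU T M U x).t = 0 := rfl
@[simp] theorem inclU_m (x : U) : (inclU T M U x).m = 0 := rfl
@[simp] theorem inclU_u (x : U) : (inclU T M U x).u = x := rfl
@[simp] theorem inclT_t (x : T) : (inclT T M U x).t = x := rfl
@[simp] theorem inclT_m (x : T) : (inclT T M U x).m = 0 := rfl
@[simp] theorem inclT_u (x : T) : (inclT T M U x).u = 0 := rfl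
omit [Module (Dorroh U) M] [Module (Dorroh Tᵐᵒᵖ) M] [SMulCommClass (Dorroh U) (Dorroh Tᵐᵒᵖ) M] in
@[simp] theorem inclM_t (x : M) : (inclM T M U x).t = 0 := rfl
omit [Module (Dorroh U) M] [Module (Dorroh Tᵐᵒᵖ) M] [SMulCommClass (Dorroh U) (Dorroh Tᵐᵒᵖ) M] in
@[simp] theorem inclM_m (x : M) : (inclM T M U x).m = x := rfl
omit [Module (Dorroh U) M] [Module (Dorroh Tᵐᵒᵖ) M] [SMulCommClass (Dorroh U) (Dorroh Tᵐᵒᵖ) M] in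
@[simp] theorem inclM_u (x : M) : (inclM T M U x).u = 0 := rfl

theorem eq_add (x : TriMat T M U) : x = inclT T M U x.t + inclM T M U x.m + inclU T M U x.u := by
  ext <;> simp

end Homs

/-! ### The idempotents of Λ: enough of them, primitivity, basicness, supports -/

section Idem

variable {T M U : Type u} [NonUnitalRing T] [NonUnitalRing U] [AddCommGroup M]
variable {I J : Type*} {e : I → U} {f : J → T}

theorem idem_inl (i : I) : idem M e f (Sum.inl i) = ⟨0, 0, e i⟩ := rfl

theorem idem_inr (j : J) : idem M e f (Sum.inr j) = ⟨f j, 0, 0⟩ := rfl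

variable [Module (Dorroh U) M] [Module (Dorroh Tᵐᵒᵖ) M] [SMulCommClass (Dorroh U) (Dorroh Tᵐᵒᵖ) M]

theorem isWEI (he : IsWEI e) (hf : IsWEI f) (hMU : IsUnitary U M) (hMT : IsUnitary Tᵐᵒᵖ M) :
    IsWEI (idem M e f) := by
  refine isWEI_of_iSup_eq_top ?_ ?_ ?_ ?_
  · rintro (i | j) <;> ext <;> simp [idem_inl, idem_inr, he.idem, hf.idem]
  · rintro (i | i) (j | j) hij
    · have h : i ≠ j := fun h => hij (congrArg _ h)
      ext <;> simp [idem_inl, he.ortho i j h]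
    · ext <;> simp [idem_inl, idem_inr]
    · ext <;> simp [idem_inl, idem_inr]
    · have h : i ≠ j := fun h => hij (congrArg _ h)
      ext <;> simp [idem_inr, hf.ortho i j h]
  · set Q := ⨆ i, rightIdeal (idem M e f) i with hQ
    have h1 : ⨆ j, rightIdeal f j ≤ Q.comap (inclT T M U : T →+ TriMat T M U) := by
      refine iSup_le fun j => ?_
      rintro _ ⟨x, rfl⟩
      exact AddSubgroup.mem_iSup_of_mem (Sum.inr j) ⟨inclT T M U x, by
        ext <;> simp [idem_inr]⟩
    have h2 : ⨆ i, rightIdeal e i ≤ Q.comap (inclU T M U : U →+ TriMat T M U) := by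
      refine iSup_le fun i => ?_
      rintro _ ⟨x, rfl⟩
      exact AddSubgroup.mem_iSup_of_mem (Sum.inl i) ⟨inclU T M U x, by
        ext <;> simp [idem_inl]⟩
    rw [hf.right_top] at h1
    rw [he.right_top] at h2
    refine (AddSubgroup.eq_top_iff' _).2 fun x => ?_
    rw [eq_add x]
    refine add_mem (add_mem (h1 (AddSubgroup.mem_top x.t)) ?_) (h2 (AddSubgroup.mem_top x.u))
    -- The lower left entry lies in the sum of the right ideals because UM = M; for the left ideals,
    -- MT = M plays this role.
    obtain ⟨s, hs⟩ := IsUnitary.exists_unit he hMU x.m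
    rw [← hs s subset_rfl, map_sum]
    refine sum_mem fun i _ => AddSubgroup.mem_iSup_of_mem (Sum.inl i) ⟨inclM T M U x.m, ?_⟩
    ext <;> simp [idem_inl]
  · set Q := ⨆ i, leftIdeal (idem M e f) i with hQ
    have h1 : ⨆ j, leftIdeal f j ≤ Q.comap (inclT T M U : T →+ TriMat T M U) := by
      refine iSup_le fun j => ?_
      rintro _ ⟨x, rfl⟩
      exact AddSubgroup.mem_iSup_of_mem (Sum.inr j) ⟨inclT T M U x, by
        ext <;> simp [idem_inr]⟩
    have h2 : ⨆ i, leftIdeal e i ≤ Q.comap (inclU T M U : U →+ TriMat T M U) := by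
      refine iSup_le fun i => ?_
      rintro _ ⟨x, rfl⟩
      exact AddSubgroup.mem_iSup_of_mem (Sum.inl i) ⟨inclU T M U x, by
        ext <;> simp [idem_inl]⟩
    rw [hf.left_top] at h1
    rw [he.left_top] at h2
    refine (AddSubgroup.eq_top_iff' _).2 fun x => ?_
    rw [eq_add x]
    refine add_mem (add_mem (h1 (AddSubgroup.mem_top x.t)) ?_) (h2 (AddSubgroup.mem_top x.u))
    obtain ⟨s, hs⟩ := IsUnitary.exists_unit hf.op hMT x.m
    rw [← hs s subset_rfl, map_sum]
    refine sum_mem fun j _ => AddSubgroup.mem_iSup_of_mem (Sum.inr j) ⟨inclM T M U x.m, ?_⟩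
    ext <;> simp [idem_inr, opFam]

/-- A matrix with zero diagonal squares to zero. -/
theorem eq_zero_of_idem {x : TriMat T M U} (hx : x * x = x) (ht : x.t = 0) (hu : x.u = 0) :
    x = 0 := by
  have hm := congrArg TriMat.m hx
  rw [mul_m, ht, hu] at hm
  ext
  · exact ht
  · simpa using hm.symm
  · exact hu

theorem eq_zero_of_add_eq_zero {R : Type*} [NonUnitalRing R] {a b : R} (ha : a * a = a)
    (hab : a * b = 0) (h : a + b = 0) : a = 0 := by
  have := congrArg (a * ·) h
  simpa [mul_add, ha, hab] using this

/-- A decomposition of the idempotent decomposes each diagonal entry. Orthogonal idempotents summing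
to zero in T both vanish, so primitivity of x in U decides, and an idempotent with zero diagonal is
zero. -/
theorem isPrimitiveIdem_inl {x : U} (h : IsPrimitiveIdem x) :
    IsPrimitiveIdem (⟨0, 0, x⟩ : TriMat T M U) := by
  obtain ⟨h1, h2, h3⟩ := h
  refine ⟨by ext <;> simp [h1], fun h0 => h2 (congrArg TriMat.u h0), ?_⟩
  intro a b ha hb hab hba hx
  have hat : a.t = 0 := eq_zero_of_add_eq_zero (congrArg TriMat.t ha) (congrArg TriMat.t hab)
    (congrArg TriMat.t hx).symm
  have hbt : b.t = 0 := eq_zero_of_add_eq_zero (congrArg TriMat.t hb) (congrArg TriMat.t hba)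
    ((add_comm _ _).trans (congrArg TriMat.t hx).symm)
  exact (h3 a.u b.u (congrArg TriMat.u ha) (congrArg TriMat.u hb) (congrArg TriMat.u hab)
    (congrArg TriMat.u hba) (congrArg TriMat.u hx)).imp (eq_zero_of_idem ha hat)
    (eq_zero_of_idem hb hbt)

theorem isPrimitiveIdem_inr {x : T} (h : IsPrimitiveIdem x) :
    IsPrimitiveIdem (⟨x, 0, 0⟩ : TriMat T M U) := by
  obtain ⟨h1, h2, h3⟩ := h
  refine ⟨by ext <;> simp [h1], fun h0 => h2 (congrArg TriMat.t h0), ?_⟩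
  intro a b ha hb hab hba hx
  have hat : a.u = 0 := eq_zero_of_add_eq_zero (congrArg TriMat.u ha) (congrArg TriMat.u hab)
    (congrArg TriMat.u hx).symm
  have hbt : b.u = 0 := eq_zero_of_add_eq_zero (congrArg TriMat.u hb) (congrArg TriMat.u hba)
    ((add_comm _ _).trans (congrArg TriMat.u hx).symm)
  exact (h3 a.t b.t (congrArg TriMat.t ha) (congrArg TriMat.t hb) (congrArg TriMat.t hab)
    (congrArg TriMat.t hba) (congrArg TriMat.t hx)).imp (fun h => eq_zero_of_idem ha h hat)
    (fun h => eq_zero_of_idem hb h hbt)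

variable {K : Type*} [CommRing K] [Module K U] [IsScalarTower K U U] [SMulCommClass K U U]
  [Module K T] [IsScalarTower K T T] [SMulCommClass K T T] [Module K M]
  [CentralAction K U M] [CentralAction K Tᵐᵒᵖ M]

theorem isBasic (he : IsBasic e K) (hf : IsBasic f K) (hMU : IsUnitary U M)
    (hMT : IsUnitary Tᵐᵒᵖ M) (hM : ∀ i j, IsFiniteLength K (biCorner M f e K i j)) :
    IsBasic (idem M e f) K := by
  have hw := isWEI he.wei hf.wei hMU hMT
  refine ⟨hw, ?_, ?_, ?_⟩
  · have key : ∀ {X : Type u} [AddCommGroup X] [Module K X] (p : Submodule K X)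
        (g : X →ₗ[K] TriMat T M U) (q : Submodule K (TriMat T M U)), IsFiniteLength K p →
        q ≤ p.map g → IsFiniteLength K q := by
      intro X _ _ p g q hp hq
      exact (hp.of_surjective (LinearMap.submoduleMap_surjective g p)).of_injective
        (Submodule.inclusion_injective hq)
    rintro (i | j) (i' | j')
    · refine key (corner e K i i') { inclU T M U with map_smul' := fun k x => ?_ } _
        (he.homFinite i i') ?_
      · ext <;> simp
      · rintro _ ⟨r, rfl⟩
        exact ⟨_, ⟨r.u, rfl⟩, by ext <;> simp [idem_inl]⟩
    · refine key (biCorner M f e K i j') { inclM T M U with map_smul' := fun k x => ?_ } _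
        (hM i j') ?_
      · ext <;> simp
      · rintro _ ⟨r, rfl⟩
        exact ⟨_, ⟨r.m, rfl⟩, by ext <;> simp [idem_inl, idem_inr]⟩
    · refine key (⊥ : Submodule K U) 0 _ IsFiniteLength.of_subsingleton ?_
      rintro _ ⟨r, rfl⟩
      exact ⟨0, zero_mem _, by ext <;> simp [idem_inl, idem_inr]⟩
    · refine key (corner f K j j') { inclT T M U with map_smul' := fun k x => ?_ } _
        (hf.homFinite j j') ?_
      · ext <;> simp
      · rintro _ ⟨r, rfl⟩
        exact ⟨_, ⟨r.t, rfl⟩, by ext <;> simp [idem_inr]⟩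
  · rintro (i | j)
    · exact isPrimitiveIdem_inl (he.primitive i)
    · exact isPrimitiveIdem_inr (hf.primitive j)
  · intro r s hrs
    rw [← not_nonempty_iff, nonempty_projMod_equiv_iff hw.idem]
    rintro ⟨a, b, ha, hb, hab, hba⟩
    -- An isomorphism between Λe_i and Λf_j would give two elements of T whose product is 0 in one
    -- order and f_j in the other, forcing f_j = 0.
    have hmixed : ∀ {R : Type u} [NonUnitalRing R] {x y z : R}, z * z = z → x * y = 0 →
        y * x = z → z = 0 := by
      intro R _ x y z hz h0 h1
      rw [← hz, ← h1, mul_assoc, ← mul_assoc x, h0, zero_mul, mul_zero]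
    rcases r with i | j <;> rcases s with i' | j'
    · have hne : i ≠ i' := fun h => hrs (congrArg _ h)
      exact not_nonempty_iff.2 (he.noniso i i' hne) ((nonempty_projMod_equiv_iff he.wei.idem i i').2
        ⟨a.u, b.u, congrArg TriMat.u ha, congrArg TriMat.u hb, congrArg TriMat.u hab,
          congrArg TriMat.u hba⟩)
    · exact (hf.primitive j').2.1 (hmixed (hf.wei.idem j') (congrArg TriMat.t hab)
        (congrArg TriMat.t hba))
    · exact (hf.primitive j).2.1 (hmixed (hf.wei.idem j) (congrArg TriMat.t hba)
        (congrArg TriMat.t hab))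
    · have hne : j ≠ j' := fun h => hrs (congrArg _ h)
      exact not_nonempty_iff.2 (hf.noniso j j' hne) ((nonempty_projMod_equiv_iff hf.wei.idem j j').2
        ⟨a.t, b.t, congrArg TriMat.t ha, congrArg TriMat.t hb, congrArg TriMat.t hab,
          congrArg TriMat.t hba⟩)

theorem isSupportFinite_left (h : IsSupportFinite (idem M e f)) : IsSupportFinite e :=
  isSupportFinite_of_injective (inclU T M U) (fun _ _ h => congrArg TriMat.u h)
    (k := Sum.inl) Sum.inl_injective (fun _ => rfl) h

theorem isSupportFinite_right (h : IsSupportFinite (idem M e f)) : IsSupportFinite f :=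
  isSupportFinite_of_injective (inclT T M U) (fun _ _ h => congrArg TriMat.t h)
    (k := Sum.inr) Sum.inr_injective (fun _ => rfl) h

end Idem

end TriMat

/-! ### Finite covers and projective dimension along restriction of scalars -/

section PullPd

variable {R S : Type u} [NonUnitalRing R] [NonUnitalRing S] {φ : R →ₙ+* S} {ψ : S →ₙ+* R}

theorem IsUnitary.of_pull {Y : ModuleCat.{u} (Dorroh S)} (h : IsUnitary R (pull φ Y)) :
    IsUnitary S Y := by
  refine (AddSubgroup.eq_top_iff' _).2 fun y => ?_
  have key : ∀ y : pull φ Y,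
      y ∈ AddSubgroup.closure {x : pull φ Y | ∃ (r : R) (m : pull φ Y), x = toD r • m} →
      (toPull φ Y).symm y ∈ AddSubgroup.closure {x : Y | ∃ (r : S) (m : Y), x = toD r • m} := by
    intro y hy
    induction hy using AddSubgroup.closure_induction with
    | mem x hx =>
      obtain ⟨r, m, rfl⟩ := hx
      obtain ⟨m, rfl⟩ := (toPull φ Y).surjective m
      rw [toD_smul_toPull, AddEquiv.symm_apply_apply]
      exact AddSubgroup.subset_closure ⟨φ r, m, rfl⟩
    | zero => rw [map_zero]; exact zero_mem _
    | add x y _ _ hx hy => rw [map_add]; exact add_mem hx hy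
    | neg x _ hx => rw [map_neg]; exact neg_mem hx
  have hy : toPull φ Y y ∈
      AddSubgroup.closure {x : pull φ Y | ∃ (r : R) (m : pull φ Y), x = toD r • m} := by
    rw [h]; trivial
  exact key _ hy

variable {I : Type v} {e : I → R}

/-- One summand for each pair of a generator n and an idempotent in a common local unit of the
generators; its own generator is sent to `e_i n`. -/
theorem IsWEI.exists_finite_cover (he : IsWEI e) {N : ModuleCat.{u} (Dorroh R)}
    (hN : IsUnitary R N) (hf : Module.Finite (Dorroh R) N) :
    ∃ (k : ℕ) (j : Fin k → I) (p : ((x : Fin k) → projMod e (j x)) →ₗ[Dorroh R] N),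
      Function.Surjective p := by
  classical
  obtain ⟨s, hs⟩ := hf.fg_top
  choose t ht using IsUnitary.exists_unit he hN
  obtain ⟨k, ⟨q⟩⟩ := Finite.exists_equiv_fin (s × (s.biUnion t))
  let p : ((x : Fin k) → projMod e (q.symm x).2.1) →ₗ[Dorroh R] N :=
    ∑ x, (projHom e (q.symm x).2.1 ((q.symm x).1.1 : N)).comp (LinearMap.proj x)
  refine ⟨k, fun x => (q.symm x).2.1, p, ?_⟩
  rw [← LinearMap.range_eq_top, eq_top_iff, ← hs, Submodule.span_le]
  intro n hn
  rw [← ht n (s.biUnion t) (Finset.subset_biUnion_of_mem t hn)]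
  refine sum_mem fun i hi => ⟨Pi.single (q (⟨n, hn⟩, ⟨i, hi⟩)) (projGen (he.idem _)), ?_⟩
  simp only [p, LinearMap.sum_apply, LinearMap.comp_apply, LinearMap.proj_apply]
  rw [Finset.sum_eq_single (q (⟨n, hn⟩, ⟨i, hi⟩))]
  · rw [Pi.single_eq_same, projHom_gen, Equiv.symm_apply_apply]
  · intro x _ hx
    rw [Pi.single_eq_of_ne hx, map_zero]
  · exact fun h => absurd (Finset.mem_univ _) h

/-- Splits off the first factor, for induction on the number of factors of a finite product. -/
theorem isSES_pi_succ {A : Type*} [Ring A] {k : ℕ} (F : Fin (k + 1) → Type*)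
    [∀ x, AddCommGroup (F x)] [∀ x, Module A (F x)] :
    IsSES (LinearMap.single A F 0)
      (LinearMap.pi fun x : Fin k => LinearMap.proj (R := A) (φ := F) x.succ) := by
  refine ⟨Pi.single_injective _, fun z => ⟨Fin.cons 0 z, ?_⟩, fun n => ⟨fun h => ⟨n 0, ?_⟩, ?_⟩⟩
  · ext x
    simp
  · ext x
    refine Fin.cases ?_ (fun y => ?_) x
    · simp
    · simpa using (congrFun h y).symm
  · rintro ⟨l, rfl⟩
    ext x
    simp

theorem isUnitary_pi {k : ℕ} (F : Fin k → Type*) [∀ x, AddCommGroup (F x)]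
    [∀ x, Module (Dorroh R) (F x)] (h : ∀ x, IsUnitary R (F x)) : IsUnitary R ((x : Fin k) → F x) := by
  classical
  refine (AddSubgroup.eq_top_iff' _).2 fun y => ?_
  rw [← Finset.univ_sum_single y]
  refine sum_mem fun x _ => ?_
  have hy : y x ∈ AddSubgroup.closure {z : F x | ∃ (r : R) (m : F x), z = toD r • m} := by
    rw [h x]; trivial
  generalize y x = z at hy ⊢
  induction hy using AddSubgroup.closure_induction with
  | mem x hx =>
    obtain ⟨r, m, rfl⟩ := hx
    exact AddSubgroup.subset_closure ⟨r, Pi.single _ m, by rw [Pi.single_smul]⟩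
  | zero => rw [Pi.single_zero]; exact zero_mem _
  | add x y _ _ hx hy => rw [Pi.single_add]; exact add_mem hx hy
  | neg x _ hx => rw [Pi.single_neg]; exact neg_mem hx

theorem IsSES.exists_pdLE_mid {A : Type u} [Ring A] {L N X : ModuleCat.{u} A} {i : L →ₗ[A] N}
    {g : N →ₗ[A] X} (h : IsSES i g) (hL : ∃ n, HasProjectiveDimensionLE L n)
    (hX : ∃ n, HasProjectiveDimensionLE X n) : ∃ n, HasProjectiveDimensionLE N n := by
  obtain ⟨n, hn⟩ := hL
  obtain ⟨m, hm⟩ := hX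
  exact ⟨max n m, h.pdLE_mid (pdLE_mono (le_max_left _ _) hn) (pdLE_mono (le_max_right _ _) hm)⟩

theorem IsSES.exists_pdLE_right {A : Type u} [Ring A] {L N X : ModuleCat.{u} A} {i : L →ₗ[A] N}
    {g : N →ₗ[A] X} (h : IsSES i g) (hL : ∃ n, HasProjectiveDimensionLE L n)
    (hN : ∃ n, HasProjectiveDimensionLE N n) : ∃ n, HasProjectiveDimensionLE X n := by
  obtain ⟨n, hn⟩ := hL
  obtain ⟨m, hm⟩ := hN
  exact ⟨max n m + 1, h.pdLE_right (pdLE_mono (le_max_left _ _) hn)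
    (pdLE_mono ((le_max_right _ _).trans (Nat.le_succ _)) hm)⟩

theorem IsSES.exists_pdLE_left {A : Type u} [Ring A] {L N X : ModuleCat.{u} A} {i : L →ₗ[A] N}
    {g : N →ₗ[A] X} (h : IsSES i g) (hN : ∃ n, HasProjectiveDimensionLE N n)
    (hX : ∃ n, HasProjectiveDimensionLE X n) : ∃ n, HasProjectiveDimensionLE L n := by
  obtain ⟨n, hn⟩ := hN
  obtain ⟨m, hm⟩ := hX
  exact ⟨max n m, h.pdLE_left (pdLE_mono (le_max_left _ _) hn)
    (pdLE_mono ((le_max_right _ _).trans (Nat.le_succ _)) hm)⟩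

theorem pdLE_of_retract {A : Type u} [Ring A] {L N : ModuleCat.{u} A} (i : L →ₗ[A] N)
    (p : N →ₗ[A] L) (h : p ∘ₗ i = LinearMap.id) {n : ℕ} (hN : HasProjectiveDimensionLE N n) :
    HasProjectiveDimensionLE L n :=
  Retract.hasProjectiveDimensionLT ⟨ModuleCat.ofHom i, ModuleCat.ofHom p, by
    ext x; exact LinearMap.congr_fun h x⟩ _

/-- If the modules `S e_i` have finite projective dimension over `R`, then so does every finitely
generated module of finite projective dimension over `S`. -/
theorem exists_pdLE_pull {e' : I → S} (he : IsWEI e')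
    (hnoeth : ∀ i, IsNoetherian (Dorroh S) (projMod e' i))
    (h : ∀ i, ∃ n, HasProjectiveDimensionLE (pull φ (ModuleCat.of (Dorroh S) (projMod e' i))) n)
    {n : ℕ} {Z : ModuleCat.{u} (Dorroh S)} (hZ : IsUnitary S Z) (hf : Module.Finite (Dorroh S) Z)
    (hn : HasProjectiveDimensionLE Z n) : ∃ m, HasProjectiveDimensionLE (pull φ Z) m := by
  have hpi : ∀ (k : ℕ) (j : Fin k → I), ∃ m, HasProjectiveDimensionLE
      (pull φ (ModuleCat.of (Dorroh S) ((x : Fin k) → projMod e' (j x)))) m := by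
    intro k
    induction k with
    | zero =>
      intro j
      have h0 : Subsingleton (pull φ (ModuleCat.of (Dorroh S) ((x : Fin 0) → projMod e' (j x)))) :=
        inferInstanceAs (Subsingleton ((x : Fin 0) → projMod e' (j x)))
      have := Module.Free.of_subsingleton (Dorroh R)
        (pull φ (ModuleCat.of (Dorroh S) ((x : Fin 0) → projMod e' (j x))))
      exact ⟨0, pdLE_zero_iff.2 Module.Projective.of_free⟩
    | succ k ih =>
      intro j
      exact IsSES.exists_pdLE_mid (IsSES.pull
        (Y := ModuleCat.of (Dorroh S) (projMod e' (j 0)))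
        (Y' := ModuleCat.of (Dorroh S) ((x : Fin (k + 1)) → projMod e' (j x)))
        (Y'' := ModuleCat.of (Dorroh S) ((x : Fin k) → projMod e' (j x.succ)))
        (isSES_pi_succ (A := Dorroh S) fun x : Fin (k + 1) => projMod e' (j x)))
        (h (j 0)) (ih fun x => j x.succ)
  have hproj : ∀ (k : ℕ) (j : Fin k → I), Module.Projective (Dorroh S)
      ((x : Fin k) → projMod e' (j x)) := by
    intro k
    induction k with
    | zero =>
      intro j
      have := Module.Free.of_subsingleton (Dorroh S) ((x : Fin 0) → projMod e' (j x))
      exact Module.Projective.of_free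
    | succ k ih =>
      intro j
      exact pdLE_zero_iff.1 (IsSES.pdLE_mid
        (L := ModuleCat.of (Dorroh S) (projMod e' (j 0)))
        (N := ModuleCat.of (Dorroh S) ((x : Fin (k + 1)) → projMod e' (j x)))
        (X := ModuleCat.of (Dorroh S) ((x : Fin k) → projMod e' (j x.succ)))
        (isSES_pi_succ (A := Dorroh S) fun x : Fin (k + 1) => projMod e' (j x))
        (pdLE_zero_iff.2 (projective_projMod (he.idem _))) (pdLE_zero_iff.2 (ih fun x => j x.succ)))
  induction n generalizing Z with
  | zero =>
    obtain ⟨k, j, p, hp⟩ := he.exists_finite_cover hZ hf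
    have hZ' : Module.Projective (Dorroh S) Z := pdLE_zero_iff.1 hn
    -- A projective Z is a retract of its finite cover, and restriction of scalars preserves
    -- retracts.
    obtain ⟨s, hs⟩ := Module.projective_lifting_property p LinearMap.id hp
    obtain ⟨m, hm⟩ := hpi k j
    let Fk := ModuleCat.of (Dorroh S) ((x : Fin k) → projMod e' (j x))
    refine ⟨m, pdLE_of_retract (pullMap φ (Y' := Fk) s) (pullMap φ (Y := Fk) p) ?_ hm⟩
    ext z
    exact LinearMap.congr_fun hs z
  | succ n ih =>
    obtain ⟨k, j, p, hp⟩ := he.exists_finite_cover hZ hf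
    have hu : IsUnitary S ((x : Fin k) → projMod e' (j x)) :=
      isUnitary_pi _ fun x => isUnitary_projMod (he.idem _)
    have hno : IsNoetherian (Dorroh S) ((x : Fin k) → projMod e' (j x)) := inferInstance
    have hses := isSES_ker p hp
    -- The syzygy has a smaller bound and, the cover being Noetherian, is again finitely generated,
    -- so the induction hypothesis applies.
    have hK : HasProjectiveDimensionLE (ModuleCat.of (Dorroh S) (LinearMap.ker p)) n :=
      IsSES.pdLE_left (N := ModuleCat.of (Dorroh S) ((x : Fin k) → projMod e' (j x))) hses
        (pdLE_mono (Nat.zero_le _) (pdLE_zero_iff.2 (hproj k j))) hn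
    have hK' := ih (Z := ModuleCat.of (Dorroh S) (LinearMap.ker p)) (hu.submodule he _)
      (inferInstanceAs (Module.Finite (Dorroh S) (LinearMap.ker p))) hK
    exact IsSES.exists_pdLE_right (IsSES.pull
      (Y := ModuleCat.of (Dorroh S) (LinearMap.ker p))
      (Y' := ModuleCat.of (Dorroh S) ((x : Fin k) → projMod e' (j x))) hses) hK' (hpi k j)

end PullPd

/-! ### Modules over the triangular matrix algebra -/

namespace TriMat

variable {T M U : Type u} [NonUnitalRing T] [NonUnitalRing U] [AddCommGroup M]
  [Module (Dorroh U) M] [Module (Dorroh Tᵐᵒᵖ) M] [SMulCommClass (Dorroh U) (Dorroh Tᵐᵒᵖ) M]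

/-! ### The submodule killed by T and exactness of both pieces -/

section Parts

variable {N N' : Type*} [AddCommGroup N] [Module (Dorroh (TriMat T M U)) N]
  [AddCommGroup N'] [Module (Dorroh (TriMat T M U)) N']

variable (T M U N) in
/-- The largest submodule annihilated by `T`. -/
noncomputable def uPart : Submodule (Dorroh (TriMat T M U)) N :=
  subOfToD
    { carrier := {n : N | ∀ t : T, toD (inclT T M U t) • n = 0}
      zero_mem' := fun t => smul_zero _
      add_mem' := fun hx hy t => by rw [smul_add, hx t, hy t, add_zero]
      neg_mem' := fun hx t => by rw [smul_neg, hx t, neg_zero] }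
    fun r n hn t => by
      have h : inclT T M U t * r = inclT T M U (t * r.t) := by ext <;> simp
      rw [← mul_smul, ← toD_mul, h]
      exact hn _

/-- As M = MT, an element killed by T is also killed by M, so only the U-entry of a matrix acts on
it. -/
theorem smul_of_mem_uPart (hMT : IsUnitary Tᵐᵒᵖ M) {n : N} (hn : n ∈ uPart T M U N)
    (r : TriMat T M U) : toD (inclU T M U r.u) • n = toD r • n := by
  have hm : ∀ m : M, toD (inclM T M U m) • n = 0 := by
    intro m
    have hm : m ∈ AddSubgroup.closure {x : M | ∃ (r : Tᵐᵒᵖ) (m : M), x = toD r • m} := by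
      rw [hMT]; trivial
    induction hm using AddSubgroup.closure_induction with
    | mem x hx =>
      obtain ⟨t, m, rfl⟩ := hx
      have h : inclM T M U (toD t • m) = inclM T M U m * inclT T M U t.unop := by ext <;> simp
      rw [h, toD_mul, mul_smul, hn, smul_zero]
    | zero => rw [map_zero, toD_zero, zero_smul]
    | add x y _ _ hx hy => rw [map_add, toD_add, add_smul, hx, hy, add_zero]
    | neg x _ hx =>
      have h : toD (inclM T M U x + inclM T M U (-x)) • n = 0 := by
        rw [← map_add, add_neg_cancel, map_zero, toD_zero, zero_smul]
      rwa [toD_add, add_smul, hx, zero_add] at h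
  conv_rhs => rw [eq_add r, toD_add, toD_add, add_smul, add_smul, hn, hm, zero_add, zero_add]

/-- The product of T with the lower row of Λ is zero, so the lower row maps N into `uPart N` and
acts as zero on the quotient. -/
theorem smul_mkQ_uPart (r : TriMat T M U) (n : N) :
    toD (inclT T M U r.t) • (uPart T M U N).mkQ n = toD r • (uPart T M U N).mkQ n := by
  have h : r = inclT T M U r.t + (inclM T M U r.m + inclU T M U r.u) := by
    rw [← add_assoc]; exact eq_add r
  conv_rhs => rw [h, toD_add, add_smul]
  rw [left_eq_add, ← map_smul]
  refine (Submodule.Quotient.mk_eq_zero _).2 fun t => ?_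
  have h : inclT T M U t * (inclM T M U r.m + inclU T M U r.u) = 0 := by ext <;> simp
  rw [← mul_smul, ← toD_mul, h, toD_zero, zero_smul]

theorem map_mem_uPart (g : N →ₗ[Dorroh (TriMat T M U)] N') {n : N} (hn : n ∈ uPart T M U N) :
    g n ∈ uPart T M U N' := fun t => by rw [← map_smul, hn, map_zero]

theorem mem_uPart_of_injective {g : N →ₗ[Dorroh (TriMat T M U)] N'} (hg : Function.Injective g)
    {n : N} (hn : g n ∈ uPart T M U N') : n ∈ uPart T M U N := fun t => hg (by
  rw [map_smul, hn, map_zero])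

variable {I J : Type*} {e : I → U} {f : J → T}

/-- A local unit for x splits into `e_i` and `f_j`, and the `f_j` kill x. The `e_i` part, applied to
any lift, gives a lift killed by T. This is the only nonformal point in the exactness of `lower` and
`upper`. -/
theorem exists_lift_uPart (hΛ : IsWEI (idem M e f)) (hN : IsUnitary (TriMat T M U) N)
    {g : N →ₗ[Dorroh (TriMat T M U)] N'} (hg : Function.Surjective g) {x : N'}
    (hx : x ∈ uPart T M U N') : ∃ n ∈ uPart T M U N, g n = x := by
  obtain ⟨n, rfl⟩ := hg x
  obtain ⟨s, hs⟩ := IsUnitary.exists_unit hΛ (hN.of_surjective g hg) (g n)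
  refine ⟨∑ r ∈ s, Sum.elim (fun i => toD (idem M e f (Sum.inl i)) • n) (fun _ => 0) r,
    sum_mem fun r _ => ?_, ?_⟩
  · rcases r with i | j
    · intro t
      have h : inclT T M U t * idem M e f (Sum.inl i) = 0 := by ext <;> simp [idem_inl]
      rw [Sum.elim_inl, ← mul_smul, ← toD_mul, h, toD_zero, zero_smul]
    · exact zero_mem _
  · conv_rhs => rw [← hs s subset_rfl]
    rw [map_sum]
    refine Finset.sum_congr rfl fun r _ => ?_
    rcases r with i | j
    · exact map_smul _ _ _
    · exact (map_zero g).trans (hx (f j)).symm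

variable {L : Type*} [AddCommGroup L] [Module (Dorroh (TriMat T M U)) L]

/-- The restriction of a homomorphism to the submodules annihilated by `T`. -/
noncomputable def uMap (g : N →ₗ[Dorroh (TriMat T M U)] N') :
    uPart T M U N →ₗ[Dorroh (TriMat T M U)] uPart T M U N' :=
  g.restrict fun _ hn => map_mem_uPart g hn

/-- The homomorphism induced on the quotients by the submodules annihilated by `T`. -/
noncomputable def tMap (g : N →ₗ[Dorroh (TriMat T M U)] N') :
    (N ⧸ uPart T M U N) →ₗ[Dorroh (TriMat T M U)] (N' ⧸ uPart T M U N') :=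
  (uPart T M U N).mapQ _ g fun _ hn => map_mem_uPart g hn

theorem isSES_uMap (hΛ : IsWEI (idem M e f)) (hN : IsUnitary (TriMat T M U) N)
    {i : L →ₗ[Dorroh (TriMat T M U)] N} {g : N →ₗ[Dorroh (TriMat T M U)] N'} (h : IsSES i g) :
    IsSES (uMap i) (uMap g) := by
  refine ⟨fun a b hab => Subtype.ext (h.inj (congrArg Subtype.val hab)), fun x => ?_, fun n => ?_⟩
  · obtain ⟨n, hn, hx⟩ := exists_lift_uPart hΛ hN h.surj x.2
    exact ⟨⟨n, hn⟩, Subtype.ext hx⟩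
  · constructor
    · intro hn
      obtain ⟨l, hl⟩ := (h.exact n.1).1 (congrArg Subtype.val hn)
      exact ⟨⟨l, mem_uPart_of_injective h.inj (hl ▸ n.2)⟩, Subtype.ext hl⟩
    · rintro ⟨l, rfl⟩
      exact Subtype.ext (h.comp_eq_zero l.1)

theorem isSES_tMap (hΛ : IsWEI (idem M e f)) (hN : IsUnitary (TriMat T M U) N)
    {i : L →ₗ[Dorroh (TriMat T M U)] N} {g : N →ₗ[Dorroh (TriMat T M U)] N'} (h : IsSES i g) :
    IsSES (tMap i) (tMap g) := by
  refine ⟨(injective_iff_map_eq_zero _).2 fun a ha => ?_, fun x => ?_, fun n => ?_⟩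
  · obtain ⟨l, rfl⟩ := Submodule.mkQ_surjective _ a
    exact (Submodule.Quotient.mk_eq_zero _).2
      (mem_uPart_of_injective h.inj ((Submodule.Quotient.mk_eq_zero _).1 ha))
  · obtain ⟨x, rfl⟩ := Submodule.mkQ_surjective _ x
    obtain ⟨n, rfl⟩ := h.surj x
    exact ⟨(uPart T M U N).mkQ n, rfl⟩
  · obtain ⟨n, rfl⟩ := Submodule.mkQ_surjective _ n
    constructor
    · intro hn
      obtain ⟨n', hn', hg⟩ := exists_lift_uPart hΛ hN h.surj
        ((Submodule.Quotient.mk_eq_zero _).1 hn)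
      obtain ⟨l, hl⟩ := (h.exact (n - n')).1 (by rw [map_sub, hg, sub_self])
      refine ⟨(uPart T M U L).mkQ l, (Submodule.Quotient.eq _).2 ?_⟩
      rw [hl, sub_sub_cancel_left]
      exact neg_mem hn'
    · rintro ⟨l, hl⟩
      obtain ⟨l, rfl⟩ := Submodule.mkQ_surjective _ l
      rw [← hl]
      exact (congrArg (uPart T M U N').mkQ (h.comp_eq_zero l)).trans (map_zero _)

end Parts

/-! ### The functors `lower` and `upper` and their inverses on inflated modules -/

section Functors

variable {N N' L : ModuleCat.{u} (Dorroh (TriMat T M U))}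

variable (N) in
/-- The `U`-module given by the submodule annihilated by `T`. -/
noncomputable def lower : ModuleCat.{u} (Dorroh U) :=
  pull (inclU T M U) (ModuleCat.of _ (uPart T M U N))

variable (N) in
/-- The `T`-module given by the quotient by the submodule annihilated by `T`. -/
noncomputable def upper : ModuleCat.{u} (Dorroh T) :=
  pull (inclT T M U) (ModuleCat.of _ (N ⧸ uPart T M U N))

/-- `uPart N` as an inflated `U`-module. -/
noncomputable def pullLower (hMT : IsUnitary Tᵐᵒᵖ M) (N : ModuleCat.{u} (Dorroh (TriMat T M U))) :
    pull (projU T M U) (lower N) ≃ₗ[Dorroh (TriMat T M U)] uPart T M U N :=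
  pullRetraction (N := ModuleCat.of _ (uPart T M U N))
    fun r n => Subtype.ext (smul_of_mem_uPart hMT n.2 r)

/-- `N / uPart N` as an inflated `T`-module. -/
noncomputable def pullUpper (N : ModuleCat.{u} (Dorroh (TriMat T M U))) :
    pull (projT T M U) (upper N) ≃ₗ[Dorroh (TriMat T M U)] (N ⧸ uPart T M U N) :=
  pullRetraction (N := ModuleCat.of _ (N ⧸ uPart T M U N)) fun r n => by
    obtain ⟨n, rfl⟩ := Submodule.mkQ_surjective _ n
    exact smul_mkQ_uPart r n

theorem isUnitary_lower (hMT : IsUnitary Tᵐᵒᵖ M) {I : Type v} {g : I → TriMat T M U}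
    (hg : IsWEI g) (hN : IsUnitary (TriMat T M U) N) : IsUnitary U (lower N) :=
  IsUnitary.of_pull (φ := projU T M U) ((hN.submodule hg (uPart T M U N)).of_surjective
    (pullLower hMT N).symm.toLinearMap (LinearEquiv.surjective _))

theorem isUnitary_upper (hN : IsUnitary (TriMat T M U) N) : IsUnitary T (upper N) :=
  IsUnitary.of_pull (φ := projT T M U) ((hN.of_surjective (uPart T M U N).mkQ
    (Submodule.mkQ_surjective _)).of_surjective
    (pullUpper N).symm.toLinearMap (LinearEquiv.surjective _))

theorem uPart_pullU (Y : ModuleCat.{u} (Dorroh U)) : uPart T M U (pull (projU T M U) Y) = ⊤ := by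
  refine (Submodule.eq_top_iff').2 fun y t => ?_
  obtain ⟨y, rfl⟩ := (toPull (projU T M U) Y).surjective y
  rw [toD_smul_toPull, projU_apply, inclT_u, toD_zero, zero_smul, map_zero]

/-- An element of a unitary T-module killed by all `f_j` is zero. -/
theorem uPart_pullT {J : Type*} {f : J → T} (hf : IsWEI f) {Z : ModuleCat.{u} (Dorroh T)}
    (hZ : IsUnitary T Z) : uPart T M U (pull (projT T M U) Z) = ⊥ := by
  refine (Submodule.eq_bot_iff _).2 fun z hz => ?_
  obtain ⟨z, rfl⟩ := (toPull (projT T M U) Z).surjective z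
  have h0 : z = 0 := IsUnitary.eq_zero hf hZ fun j => by
    have := hz (f j)
    rw [toD_smul_toPull] at this
    exact (toPull (projT T M U) Z).map_eq_zero_iff.1 this
  rw [h0, map_zero]

/-- The `U`-module of an inflated `U`-module. -/
noncomputable def lowerPull (Y : ModuleCat.{u} (Dorroh U)) :
    lower (pull (projU T M U) Y) ≃ₗ[Dorroh U] Y :=
  (pullEquiv (inclU T M U) (Y := ModuleCat.of _ (uPart T M U (pull (projU T M U) Y)))
    (Y' := pull (projU T M U) Y)
    ((LinearEquiv.ofEq _ _ (uPart_pullU Y)).trans Submodule.topEquiv)).trans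
    (pullSection fun _ => rfl)

/-- The `T`-module of an inflated `T`-module. -/
noncomputable def upperPull {J : Type*} {f : J → T} (hf : IsWEI f) {Z : ModuleCat.{u} (Dorroh T)}
    (hZ : IsUnitary T Z) : upper (pull (projT T M U) Z) ≃ₗ[Dorroh T] Z :=
  (pullEquiv (inclT T M U) (Y := ModuleCat.of _ (_ ⧸ uPart T M U (pull (projT T M U) Z)))
    (Y' := pull (projT T M U) Z)
    (Submodule.quotEquivOfEqBot _ (uPart_pullT hf hZ))).trans (pullSection fun _ => rfl)

theorem subsingleton_lower_pullT {J : Type*} {f : J → T} (hf : IsWEI f)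
    {Z : ModuleCat.{u} (Dorroh T)} (hZ : IsUnitary T Z) :
    Subsingleton (lower (pull (projT T M U) Z)) := by
  have h : Subsingleton (uPart T M U (pull (projT T M U) Z)) := by
    rw [uPart_pullT hf hZ]; infer_instance
  exact h

theorem subsingleton_upper_pullU (Y : ModuleCat.{u} (Dorroh U)) :
    Subsingleton (upper (pull (projU T M U) Y)) := by
  have h : Subsingleton ((pull (projU T M U) Y) ⧸ uPart T M U (pull (projU T M U) Y)) :=
    Submodule.Quotient.subsingleton_iff.2 (uPart_pullU Y)
  exact h

variable {I : Type v} {J : Type w} {e : I → U} {f : J → T}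

theorem isSES_lower (hΛ : IsWEI (idem M e f)) (hN : IsUnitary (TriMat T M U) N)
    {i : L →ₗ[Dorroh (TriMat T M U)] N} {g : N →ₗ[Dorroh (TriMat T M U)] N'} (h : IsSES i g) :
    IsSES (pullMap (inclU T M U) (Y := ModuleCat.of _ (uPart T M U L))
      (Y' := ModuleCat.of _ (uPart T M U N)) (uMap i) : lower L →ₗ[Dorroh U] lower N)
      (pullMap (inclU T M U) (Y := ModuleCat.of _ (uPart T M U N))
      (Y' := ModuleCat.of _ (uPart T M U N')) (uMap g) : lower N →ₗ[Dorroh U] lower N') :=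
  IsSES.pull (Y := ModuleCat.of _ (uPart T M U L)) (Y' := ModuleCat.of _ (uPart T M U N))
    (Y'' := ModuleCat.of _ (uPart T M U N')) (isSES_uMap hΛ hN h)

theorem isSES_upper (hΛ : IsWEI (idem M e f)) (hN : IsUnitary (TriMat T M U) N)
    {i : L →ₗ[Dorroh (TriMat T M U)] N} {g : N →ₗ[Dorroh (TriMat T M U)] N'} (h : IsSES i g) :
    IsSES (pullMap (inclT T M U) (Y := ModuleCat.of _ (L ⧸ uPart T M U L))
      (Y' := ModuleCat.of _ (N ⧸ uPart T M U N)) (tMap i) : upper L →ₗ[Dorroh T] upper N)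
      (pullMap (inclT T M U) (Y := ModuleCat.of _ (N ⧸ uPart T M U N))
      (Y' := ModuleCat.of _ (N' ⧸ uPart T M U N')) (tMap g) : upper N →ₗ[Dorroh T] upper N') :=
  IsSES.pull (Y := ModuleCat.of _ (L ⧸ uPart T M U L)) (Y' := ModuleCat.of _ (N ⧸ uPart T M U N))
    (Y'' := ModuleCat.of _ (N' ⧸ uPart T M U N')) (isSES_tMap hΛ hN h)

/-- Obtained from exactness, applied to an isomorphism as a surjection with zero kernel. -/
theorem nonempty_lower_equiv (hΛ : IsWEI (idem M e f)) (hN : IsUnitary (TriMat T M U) N)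
    (φ : N ≃ₗ[Dorroh (TriMat T M U)] N') : Nonempty (lower N ≃ₗ[Dorroh U] lower N') := by
  let L : ModuleCat.{u} (Dorroh (TriMat T M U)) := ModuleCat.of _ (LinearMap.ker φ.toLinearMap)
  have h := isSES_lower (N := N) (N' := N') (L := L) hΛ hN (isSES_ker φ.toLinearMap φ.surjective)
  refine ⟨LinearEquiv.ofBijective _ ⟨(injective_iff_map_eq_zero _).2 fun n hn => ?_, h.surj⟩⟩
  obtain ⟨l, rfl⟩ := (h.exact n).1 hn
  have hker : Subsingleton (LinearMap.ker φ.toLinearMap) := by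
    rw [LinearMap.ker_eq_bot.2 φ.injective]; infer_instance
  have hpart : Subsingleton (uPart T M U (LinearMap.ker φ.toLinearMap)) := inferInstance
  have : Subsingleton (lower L) := hpart
  have hl : l = 0 := @Subsingleton.elim _ this _ _
  rw [hl]
  exact map_zero _

theorem nonempty_upper_equiv (hΛ : IsWEI (idem M e f)) (hN : IsUnitary (TriMat T M U) N)
    (φ : N ≃ₗ[Dorroh (TriMat T M U)] N') : Nonempty (upper N ≃ₗ[Dorroh T] upper N') := by
  let L : ModuleCat.{u} (Dorroh (TriMat T M U)) := ModuleCat.of _ (LinearMap.ker φ.toLinearMap)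
  have h := isSES_upper (N := N) (N' := N') (L := L) hΛ hN (isSES_ker φ.toLinearMap φ.surjective)
  refine ⟨LinearEquiv.ofBijective _ ⟨(injective_iff_map_eq_zero _).2 fun n hn => ?_, h.surj⟩⟩
  obtain ⟨l, rfl⟩ := (h.exact n).1 hn
  have hker : Subsingleton (LinearMap.ker φ.toLinearMap) := by
    rw [LinearMap.ker_eq_bot.2 φ.injective]; infer_instance
  have hpart : Subsingleton ((LinearMap.ker φ.toLinearMap) ⧸
      uPart T M U (LinearMap.ker φ.toLinearMap)) := inferInstance
  have : Subsingleton (upper L) := hpart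
  have hl : l = 0 := @Subsingleton.elim _ this _ _
  rw [hl]
  exact map_zero _

end Functors

end TriMat

/-- Dimension shifting, with a projective middle term. -/
theorem IsSES.pdLE_right_iff {S : Type u} [Ring S] {L N X : ModuleCat.{u} S} {i : L →ₗ[S] N}
    {g : N →ₗ[S] X} (h : IsSES i g) (hN : Module.Projective S N) (n : ℕ) :
    HasProjectiveDimensionLE X (n + 1) ↔ HasProjectiveDimensionLE L n :=
  ⟨fun hX => h.pdLE_left (pdLE_mono (Nat.zero_le _) (pdLE_zero_iff.2 hN)) hX,
    fun hL => h.pdLE_right hL (pdLE_mono (Nat.zero_le _) (pdLE_zero_iff.2 hN))⟩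

/-! ### Joint partitions -/

section JoinPart

variable {I J ι κ : Type*} {A : ι → Set I} {B : κ → Set J}

theorem isPartition_joinPart (hA : IsPartition A) (hB : IsPartition B) :
    IsPartition (joinPart A B) := by
  refine ⟨?_, ?_, ?_⟩
  · rintro (a | b)
    · exact (hA.nonempty a).image _
    · exact (hB.nonempty b).image _
  · rintro (a | a) (b | b) hab
    · exact (Set.disjoint_image_iff Sum.inl_injective).2
        (hA.disjoint a b fun h => hab (congrArg _ h))
    · exact Set.disjoint_image_inl_image_inr
    · exact Set.disjoint_image_inl_image_inr.symm
    · exact (Set.disjoint_image_iff Sum.inr_injective).2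
        (hB.disjoint a b fun h => hab (congrArg _ h))
  · rintro (i | j)
    · obtain ⟨a, ha⟩ := hA.cover i
      exact ⟨toLex (Sum.inl a), i, ha, rfl⟩
    · obtain ⟨b, hb⟩ := hB.cover j
      exact ⟨toLex (Sum.inr b), j, hb, rfl⟩

variable [LinearOrder ι] [LinearOrder κ]

theorem mem_lowerIdx_inl {a : ι} {r : I ⊕ J} :
    r ∈ lowerIdx (joinPart A B) (toLex (Sum.inl a)) ↔ ∃ i ∈ lowerIdx A a, Sum.inl i = r := by
  constructor
  · rintro ⟨b | b, hb, hr⟩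
    · obtain ⟨i, hi, rfl⟩ := hr
      exact ⟨i, ⟨b, Sum.Lex.inl_lt_inl_iff.1 hb, hi⟩, rfl⟩
    · exact absurd hb Sum.Lex.not_inr_lt_inl
  · rintro ⟨i, ⟨b, hb, hi⟩, rfl⟩
    exact ⟨toLex (Sum.inl b), Sum.Lex.inl_lt_inl_iff.2 hb, i, hi, rfl⟩

/-- All of I lies below every block of J, because the blocks of `A` cover I. -/
theorem mem_lowerIdx_inr (hA : IsPartition A) {b : κ} {r : I ⊕ J} :
    r ∈ lowerIdx (joinPart A B) (toLex (Sum.inr b)) ↔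
      (∃ i, Sum.inl i = r) ∨ ∃ j ∈ lowerIdx B b, Sum.inr j = r := by
  constructor
  · rintro ⟨c | c, hc, hr⟩
    · obtain ⟨i, hi, rfl⟩ := hr
      exact Or.inl ⟨i, rfl⟩
    · obtain ⟨j, hj, rfl⟩ := hr
      exact Or.inr ⟨j, ⟨c, Sum.Lex.inr_lt_inr_iff.1 hc, hj⟩, rfl⟩
  · rintro (⟨i, rfl⟩ | ⟨j, ⟨c, hc, hj⟩, rfl⟩)
    · obtain ⟨a, ha⟩ := hA.cover i
      exact ⟨toLex (Sum.inl a), Sum.Lex.inl_lt_inr _ _, i, ha, rfl⟩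
    · exact ⟨toLex (Sum.inr c), Sum.Lex.inr_lt_inr_iff.2 hc, j, hj, rfl⟩

end JoinPart

namespace TriMat

variable {T M U : Type u} [NonUnitalRing T] [NonUnitalRing U] [AddCommGroup M]
  [Module (Dorroh U) M] [Module (Dorroh Tᵐᵒᵖ) M] [SMulCommClass (Dorroh U) (Dorroh Tᵐᵒᵖ) M]
  {I : Type v} {J : Type w} {e : I → U} {f : J → T}

/-! ### Projective dimension under inflation and under `upper` -/

section ProjectiveDimension

variable {N : ModuleCat.{u} (Dorroh (TriMat T M U))}

/-- A homomorphism from an inflated U-module lands in `uPart`, so inflation is left adjoint to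
`lower`. As `lower` preserves surjections of unitary modules, inflation preserves projectives. -/
theorem projective_pullU (hΛ : IsWEI (idem M e f)) (hMT : IsUnitary Tᵐᵒᵖ M)
    {P : ModuleCat.{u} (Dorroh U)} (hP : IsUnitary U P) (h : Module.Projective (Dorroh U) P) :
    Module.Projective (Dorroh (TriMat T M U)) (pull (projU T M U) P) := by
  refine ((hΛ.isProj_iff _).1 ⟨isUnitary_pull (projU_surjective T M U) hP,
    fun X Y hX hY g k hg => ?_⟩).2
  let g' : lower X →ₗ[Dorroh U] lower Y :=
    pullMap (inclU T M U) (Y := ModuleCat.of _ (uPart T M U X))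
      (Y' := ModuleCat.of _ (uPart T M U Y)) (uMap g)
  have hg' : Function.Surjective g' :=
    (isSES_lower (L := ModuleCat.of _ (LinearMap.ker g)) hΛ hX (isSES_ker g hg)).surj
  let k' : lower (pull (projU T M U) P) →ₗ[Dorroh U] lower Y :=
    pullMap (inclU T M U) (Y := ModuleCat.of _ (uPart T M U (pull (projU T M U) P)))
      (Y' := ModuleCat.of _ (uPart T M U Y)) (uMap k)
  obtain ⟨h', hh'⟩ := Module.projective_lifting_property g'
    (k'.comp (lowerPull (T := T) (M := M) P).symm.toLinearMap) hg'
  refine ⟨(uPart T M U X).subtype.comp ((pullLower hMT X).toLinearMap.comp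
    (pullMap (projU T M U) h')), LinearMap.ext fun p => ?_⟩
  have hp : p ∈ uPart T M U (pull (projU T M U) P) := by rw [uPart_pullU]; trivial
  let q : lower (pull (projU T M U) P) :=
    toPull (inclU T M U) (ModuleCat.of _ (uPart T M U (pull (projU T M U) P))) ⟨p, hp⟩
  have h1 : g' (h' (lowerPull P q)) = k' q := by
    have := LinearMap.congr_fun hh' (lowerPull P q)
    simpa using this
  exact congrArg (fun y : lower Y =>
    ((toPull (inclU T M U) (ModuleCat.of _ (uPart T M U Y))).symm y : uPart T M U Y).1) h1

/-- A lifting problem over U is inflated and solved over Λ; the solution is U-linear because Λ → U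
is surjective. -/
theorem projective_of_pullU (he : IsWEI e) {P : ModuleCat.{u} (Dorroh U)} (hP : IsUnitary U P)
    (h : Module.Projective (Dorroh (TriMat T M U)) (pull (projU T M U) P)) :
    Module.Projective (Dorroh U) P := by
  refine ((he.isProj_iff _).1 ⟨hP, fun X Y _ _ g k hg => ?_⟩).2
  obtain ⟨h', hh'⟩ := Module.projective_lifting_property (pullMap (projU T M U) g)
    (pullMap (projU T M U) k) hg
  exact ⟨unpullMap (projU_surjective T M U) h', LinearMap.ext fun p => LinearMap.congr_fun hh' p⟩

theorem pdLE_pullU_iff (hΛ : IsWEI (idem M e f)) (hMT : IsUnitary Tᵐᵒᵖ M) (he : IsWEI e)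
    {Y : ModuleCat.{u} (Dorroh U)} (hY : IsUnitary U Y) (n : ℕ) :
    HasProjectiveDimensionLE (pull (projU T M U) Y) n ↔ HasProjectiveDimensionLE Y n := by
  induction n generalizing Y with
  | zero =>
    rw [pdLE_zero_iff, pdLE_zero_iff]
    exact ⟨projective_of_pullU he hY, projective_pullU hΛ hMT hY⟩
  | succ n ih =>
    obtain ⟨P, p, hP, hP', hp⟩ := he.exists_cover Y hY
    have h := IsSES.pull (φ := projU T M U) (Y := ModuleCat.of _ (LinearMap.ker p)) (isSES_ker p hp)
    rw [h.pdLE_right_iff (projective_pullU hΛ hMT hP hP'), ih (hP.submodule he _)]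
    exact (IsSES.pdLE_right_iff (L := ModuleCat.of _ (LinearMap.ker p)) (isSES_ker p hp) hP' n).symm

/-- `upper` is left adjoint to inflation from T, which preserves surjections. -/
theorem projective_upper (hf : IsWEI f) (hN : IsUnitary (TriMat T M U) N)
    (h : Module.Projective (Dorroh (TriMat T M U)) N) :
    Module.Projective (Dorroh T) (upper N) := by
  refine ((hf.isProj_iff _).1 ⟨isUnitary_upper hN, fun X Y hX hY g k hg => ?_⟩).2
  obtain ⟨h', hh'⟩ := Module.projective_lifting_property (pullMap (projT T M U) g)
    ((pullMap (projT T M U) k).comp ((pullUpper N).symm.toLinearMap.comp (uPart T M U N).mkQ)) hg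
  let h'' : upper N →ₗ[Dorroh T] upper (pull (projT T M U) X) :=
    pullMap (inclT T M U) (Y := ModuleCat.of _ (N ⧸ uPart T M U N))
      (Y' := ModuleCat.of _ (_ ⧸ uPart T M U (pull (projT T M U) X))) (tMap h')
  refine ⟨(upperPull hf hX).toLinearMap.comp h'', LinearMap.ext fun z => ?_⟩
  obtain ⟨z, rfl⟩ := (toPull (inclT T M U) (ModuleCat.of _ (N ⧸ uPart T M U N))).surjective z
  obtain ⟨n, rfl⟩ := Submodule.mkQ_surjective _ z
  have h1 := LinearMap.congr_fun hh' n
  have h2 : (pullUpper N).symm ((uPart T M U N).mkQ n) = toPull (projT T M U) (upper N)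
      (toPull (inclT T M U) (ModuleCat.of _ (N ⧸ uPart T M U N)) ((uPart T M U N).mkQ n)) :=
    (LinearEquiv.symm_apply_eq _).2 rfl
  rw [LinearMap.comp_apply, LinearMap.comp_apply, LinearMap.comp_apply, LinearEquiv.coe_coe, h2]
    at h1
  exact h1

theorem pdLE_upper (hΛ : IsWEI (idem M e f)) (hf : IsWEI f) (hN : IsUnitary (TriMat T M U) N)
    {n : ℕ} (h : HasProjectiveDimensionLE N n) : HasProjectiveDimensionLE (upper N) n := by
  induction n generalizing N with
  | zero => exact pdLE_zero_iff.2 (projective_upper hf hN (pdLE_zero_iff.1 h))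
  | succ n ih =>
    obtain ⟨P, p, hP, hP', hp⟩ := hΛ.exists_cover N hN
    have hK := (IsSES.pdLE_right_iff (L := ModuleCat.of _ (LinearMap.ker p)) (isSES_ker p hp)
      hP' n).1 h
    exact (isSES_upper (L := ModuleCat.of _ (LinearMap.ker p)) hΛ hP
      (isSES_ker p hp)).pdLE_right (ih (hP.submodule hΛ _) hK)
      (pdLE_mono (Nat.zero_le _) (pdLE_zero_iff.2 (projective_upper hf hP hP')))

/-- The sequence `0 → M f_j → Λ f_j → T f_j → 0`. -/
theorem exists_pdLE_pullT_projMod (hΛ : IsWEI (idem M e f)) (hMU : IsUnitary U M)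
    (hMT : IsUnitary Tᵐᵒᵖ M) (he : IsWEI e)
    (hpd : ∀ j, pd (ModuleCat.of (Dorroh U) (colMod U M f j)) < ⊤) (j : J) :
    ∃ n, HasProjectiveDimensionLE
      (pull (projT T M U) (ModuleCat.of (Dorroh T) (projMod f j))) n := by
  let C : ModuleCat.{u} (Dorroh U) := ModuleCat.of (Dorroh U) (colMod U M f j)
  have hC : IsUnitary U C := hMU.submodule he _
  obtain ⟨n, hn⟩ := (pd_lt_top_iff he hC).1 (hpd j)
  have hj : projT T M U (idem M e f (Sum.inr j)) = f j := rfl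
  have hmem : ∀ c : C, toD (inclM T M U ((c : colMod U M f j) : M)) ∈
      projMod (idem M e f) (Sum.inr j) := by
    rintro ⟨_, m, rfl⟩
    exact ⟨inclM T M U m, congrArg toD (by ext <;> simp [idem_inr])⟩
  let i : pull (projU T M U) C →ₗ[Dorroh (TriMat T M U)] projMod (idem M e f) (Sum.inr j) :=
    linOfToD
      { toFun := fun c => ⟨toD (inclM T M U (((toPull _ C).symm c : colMod U M f j) : M)), hmem _⟩
        map_zero' := Subtype.ext (by simp)
        map_add' := fun a b => Subtype.ext
          ((congrArg toD (map_add (inclM T M U) _ _)).trans (toD_add _ _)) }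
      fun r c => by
        obtain ⟨c, rfl⟩ := (toPull (projU T M U) C).surjective c
        rw [toD_smul_toPull]
        refine Subtype.ext ?_
        change toD (inclM T M U (toD r.u • (c : colMod U M f j).1)) =
          toD r * toD (inclM T M U (c : colMod U M f j).1)
        rw [← toD_mul]
        exact congrArg toD (by ext <;> simp)
  have hses : IsSES (L := pull (projU T M U) C)
      (N := ModuleCat.of (Dorroh (TriMat T M U)) (projMod (idem M e f) (Sum.inr j)))
      (X := pull (projT T M U) (ModuleCat.of (Dorroh T) (projMod f j))) i (projMap hj) := by
    refine ⟨(injective_iff_map_eq_zero i).2 fun c hc => ?_,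
      projMap_surjective hj (projT_surjective T M U), fun x => ?_⟩
    · have h0 : toD (inclM T M U (((toPull _ C).symm c : colMod U M f j) : M)) = toD 0 :=
        (congrArg Subtype.val hc).trans toD_zero.symm
      have h1 : (((toPull _ C).symm c : colMod U M f j) : M) = 0 :=
        congrArg TriMat.m (toD_injective h0)
      exact (toPull _ C).symm.map_eq_zero_iff.1 (Subtype.ext h1)
    · rw [projMap_eq_zero_iff]
      constructor
      · intro hx
        obtain ⟨_, r, rfl⟩ := x
        have ht : (r * idem M e f (Sum.inr j)).t = 0 := by
          refine toD_injective ?_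
          rw [toD_zero, ← hx]
          exact (Dorroh.map_toD (projT T M U) (r * idem M e f (Sum.inr j))).symm
        refine ⟨toPull _ C ⟨toD (MulOpposite.op (f j)) • r.m, r.m, rfl⟩, Subtype.ext ?_⟩
        refine congrArg toD ?_
        ext
        · exact ht.symm
        · simp [idem_inr]
        · simp [idem_inr]
      · rintro ⟨c, rfl⟩
        exact (Dorroh.map_toD (projT T M U) _).trans toD_zero
  -- The left term has finite projective dimension by the hypothesis on Mf_j, inflated from U, and
  -- the middle term is projective.
  exact hses.exists_pdLE_right ⟨n, (pdLE_pullU_iff hΛ hMT he hC n).2 hn⟩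
    ⟨0, (pdLE_zero_iff (L := ModuleCat.of (Dorroh (TriMat T M U))
      (projMod (idem M e f) (Sum.inr j)))).2 (projective_projMod (hΛ.idem _))⟩

end ProjectiveDimension

/-! ### Finitely generated modules of finite projective dimension over Λ, U and T -/

section FinPd

variable (hΛ : IsWEI (idem M e f)) (hMU : IsUnitary U M) (hMT : IsUnitary Tᵐᵒᵖ M)
  (he : IsWEI e) (hf : IsWEI f)
  (hpd : ∀ j, pd (ModuleCat.of (Dorroh U) (colMod U M f j)) < ⊤)
  (hnΛ : ∀ r, IsNoetherian (Dorroh (TriMat T M U)) (projMod (idem M e f) r))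
  (hnT : ∀ j, IsNoetherian (Dorroh T) (projMod f j))

include hΛ hMT he in
theorem finPd_pullU_iff {Y : ModuleCat.{u} (Dorroh U)} (hY : IsUnitary U Y) :
    finPd (TriMat T M U) (pull (projU T M U) Y) ↔ finPd U Y := by
  have hY' := isUnitary_pull (projU_surjective T M U) hY
  rw [finPd, finPd, pd_lt_top_iff hΛ hY', pd_lt_top_iff he hY,
    finite_pull_iff (projU_surjective T M U)]
  simp only [pdLE_pullU_iff hΛ hMT he hY, hY, hY']

include hΛ hMU hMT he hf hpd hnT in
theorem finPd_pullT {Z : ModuleCat.{u} (Dorroh T)} (hZ : finPd T Z) :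
    finPd (TriMat T M U) (pull (projT T M U) Z) := by
  have hZ' := isUnitary_pull (projT_surjective T M U) hZ.1
  obtain ⟨n, hn⟩ := (pd_lt_top_iff hf hZ.1).1 hZ.2.2
  exact ⟨hZ', (finite_pull_iff (projT_surjective T M U)).2 hZ.2.1, (pd_lt_top_iff hΛ hZ').2
    (exists_pdLE_pull hf hnT (exists_pdLE_pullT_projMod hΛ hMU hMT he hpd) hZ.1 hZ.2.1 hn)⟩

include hΛ hf in
theorem finPd_upper {N : ModuleCat.{u} (Dorroh (TriMat T M U))} (hN : finPd (TriMat T M U) N) :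
    finPd T (upper N) := by
  have hu := isUnitary_upper hN.1
  obtain ⟨n, hn⟩ := (pd_lt_top_iff hΛ hN.1).1 hN.2.2
  have := hN.2.1
  refine ⟨hu, ?_, (pd_lt_top_iff hf hu).2 ⟨n, pdLE_upper hΛ hf hN.1 hn⟩⟩
  exact (finite_pull_iff (projT_surjective T M U)).1 (Module.Finite.equiv (pullUpper N).symm)

include hΛ hMU hMT he hf hpd hnT in
theorem finPd_pullT_iff {Z : ModuleCat.{u} (Dorroh T)} (hZ : IsUnitary T Z) :
    finPd (TriMat T M U) (pull (projT T M U) Z) ↔ finPd T Z :=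
  ⟨fun h => (finPd_upper hΛ hf h).of_equiv hf (upperPull hf hZ),
    finPd_pullT hΛ hMU hMT he hf hpd hnT⟩

include hΛ hMU hMT he hf hpd hnΛ hnT in
-- Extensions give one direction. For the other, `upper N` is in the class over T, so its inflation
-- is in the class over Λ; then `uPart N` is the kernel of a map between modules of finite
-- projective dimension, and it is finitely generated because N is Noetherian.
theorem finPd_iff {N : ModuleCat.{u} (Dorroh (TriMat T M U))} (hN : IsUnitary (TriMat T M U) N) :
    finPd (TriMat T M U) N ↔ finPd U (lower N) ∧ finPd T (upper N) := by
  have hl := isUnitary_lower hMT hΛ hN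
  have hses : IsSES (L := ModuleCat.of (Dorroh (TriMat T M U)) (uPart T M U N))
    (X := ModuleCat.of (Dorroh (TriMat T M U)) (N ⧸ uPart T M U N))
    (uPart T M U N).subtype (uPart T M U N).mkQ := isSES_mkQ _
  constructor
  · intro h
    have hup := finPd_upper hΛ hf h
    refine ⟨(finPd_pullU_iff hΛ hMT he hl).1 ?_, hup⟩
    refine finPd.of_equiv hΛ (L := ModuleCat.of _ (uPart T M U N)) ?_ (pullLower hMT N).symm
    have hq : finPd (TriMat T M U) (ModuleCat.of _ (N ⧸ uPart T M U N)) :=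
      (finPd_pullT hΛ hMU hMT he hf hpd hnT hup).of_equiv hΛ (pullUpper N)
    have hno : IsNoetherian (Dorroh (TriMat T M U)) N := hΛ.isNoetherian hnΛ hN h.2.1
    have hun : IsUnitary (TriMat T M U) (uPart T M U N) := hN.submodule hΛ _
    exact ⟨hun, inferInstanceAs
      (Module.Finite (Dorroh (TriMat T M U)) (uPart T M U N)), (pd_lt_top_iff hΛ hun).2
      (hses.exists_pdLE_left ((pd_lt_top_iff hΛ hN).1 h.2.2) ((pd_lt_top_iff hΛ hq.1).1 hq.2.2))⟩
  · rintro ⟨h1, h2⟩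
    exact hses.finPd_mid hΛ hN
      (finPd.of_equiv hΛ (N := ModuleCat.of _ (uPart T M U N))
        ((finPd_pullU_iff hΛ hMT he hl).2 h1) (pullLower hMT N))
      (finPd.of_equiv hΛ (N := ModuleCat.of _ (N ⧸ uPart T M U N))
        (finPd_pullT hΛ hMU hMT he hf hpd hnT h2) (pullUpper N))

end FinPd

/-! ### Filtrations by standard modules -/

section Filtrations

variable {ι κ : Type*} [LinearOrder ι] [LinearOrder κ] {A : ι → Set I} {B : κ → Set J}

variable (hΛ : IsWEI (idem M e f)) (he : IsWEI e) (hf : IsWEI f)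

include hΛ he in
-- Λe_t has entries only in the U-corner, so Λ → U is injective on it.
theorem nonempty_stdMod_inl_equiv (a : ι) (t : I) :
    Nonempty (stdMod (idem M e f) (joinPart A B) (toLex (Sum.inl a)) (Sum.inl t)
      ≃ₗ[Dorroh (TriMat T M U)] pull (projU T M U) (stdMod e A a t)) := by
  refine nonempty_stdMod_equiv (projU_surjective T M U) hΛ.idem he.idem rfl ?_ ?_ ?_
  · intro r hr
    obtain ⟨i, hi, rfl⟩ := mem_lowerIdx_inl.1 hr
    exact Or.inr ⟨i, hi, rfl⟩
  · exact fun i hi => ⟨Sum.inl i, mem_lowerIdx_inl.2 ⟨i, hi, rfl⟩, rfl⟩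
  · rintro ⟨_, r, rfl⟩ hx
    have hu : (r * idem M e f (Sum.inl t)).u = 0 := by
      refine toD_injective ?_
      rw [toD_zero, ← hx]
      exact (Dorroh.map_toD (projU T M U) (r * idem M e f (Sum.inl t))).symm
    have h0 : r * idem M e f (Sum.inl t) = 0 := by
      ext
      · simp [idem_inl]
      · simp [idem_inl]
      · exact hu
    have : (⟨toD (r * idem M e f (Sum.inl t)), r, rfl⟩ : projMod (idem M e f) (Sum.inl t)) = 0 :=
      Subtype.ext ((congrArg toD h0).trans toD_zero)
    rw [this]
    exact zero_mem _

include hΛ hf in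
-- The kernel of Λf_t → Tf_t is Mf_t. It is killed by the `f_j`, so it is generated by its parts
-- under the `e_i`, which lie in the trace since I precedes J.
theorem nonempty_stdMod_inr_equiv (hA : IsPartition A) (b : κ) (t : J) :
    Nonempty (stdMod (idem M e f) (joinPart A B) (toLex (Sum.inr b)) (Sum.inr t)
      ≃ₗ[Dorroh (TriMat T M U)] pull (projT T M U) (stdMod f B b t)) := by
  refine nonempty_stdMod_equiv (projT_surjective T M U) hΛ.idem hf.idem rfl ?_ ?_ ?_
  · intro r hr
    rcases (mem_lowerIdx_inr hA).1 hr with ⟨i, rfl⟩ | ⟨j, hj, rfl⟩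
    · exact Or.inl rfl
    · exact Or.inr ⟨j, hj, rfl⟩
  · exact fun j hj => ⟨Sum.inr j, (mem_lowerIdx_inr hA).2 (Or.inr ⟨j, hj, rfl⟩), rfl⟩
  · intro x hx
    obtain ⟨s, hs⟩ := IsUnitary.exists_unit hΛ (isUnitary_projMod (hΛ.idem _)) x
    rw [← hs s subset_rfl]
    refine sum_mem fun r _ => ?_
    rcases r with i | j
    · exact smul_mem_stdTrace hΛ.idem ((mem_lowerIdx_inr hA).2 (Or.inl ⟨i, rfl⟩)) x
    · obtain ⟨_, r, rfl⟩ := x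
      have ht : (r * idem M e f (Sum.inr t)).t = 0 := by
        refine toD_injective ?_
        rw [toD_zero, ← hx]
        exact (Dorroh.map_toD (projT T M U) (r * idem M e f (Sum.inr t))).symm
      have h0 : idem M e f (Sum.inr j) * (r * idem M e f (Sum.inr t)) = 0 := by
        ext
        · rw [mul_t, ht, mul_zero]; rfl
        · rw [mul_m, ht]; simp [idem_inr]
        · simp [idem_inr]
      have : toD (idem M e f (Sum.inr j)) •
          (⟨toD (r * idem M e f (Sum.inr t)), r, rfl⟩ : projMod (idem M e f) (Sum.inr t)) = 0 :=
        Subtype.ext ((toD_mul _ _).symm.trans ((congrArg toD h0).trans toD_zero))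
      rw [this]
      exact zero_mem _

include hΛ he in
theorem filt_pullU {Y : ModuleCat.{u} (Dorroh U)} (hY : Filt (stdClass e A) Y) :
    Filt (stdClass (idem M e f) (joinPart A B)) (pull (projU T M U) Y) := by
  refine Filt.pull he (projU_surjective T M U) ?_ hΛ hY
  rintro _ ⟨a, -, t, ht, rfl⟩
  obtain ⟨φ⟩ := nonempty_stdMod_inl_equiv (A := A) (B := B) hΛ he a t
  exact Filt.of_mem (isUnitary_pull (projU_surjective T M U) (isUnitary_stdMod he.idem A a t))
    φ.symm ⟨toLex (Sum.inl a), trivial, Sum.inl t, ⟨t, ht, rfl⟩, rfl⟩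

include hΛ hf in
theorem filt_pullT (hA : IsPartition A) {Z : ModuleCat.{u} (Dorroh T)}
    (hZ : Filt (stdClass f B) Z) :
    Filt (stdClass (idem M e f) (joinPart A B)) (pull (projT T M U) Z) := by
  refine Filt.pull hf (projT_surjective T M U) ?_ hΛ hZ
  rintro _ ⟨b, -, t, ht, rfl⟩
  obtain ⟨φ⟩ := nonempty_stdMod_inr_equiv (A := A) (B := B) hΛ hf hA b t
  exact Filt.of_mem (isUnitary_pull (projT_surjective T M U) (isUnitary_stdMod hf.idem B b t))
    φ.symm ⟨toLex (Sum.inr b), trivial, Sum.inr t, ⟨t, ht, rfl⟩, rfl⟩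

include hΛ he hf in
-- `lower` is exact, sends the standard modules indexed by I to those of U, and kills those indexed
-- by J.
theorem filt_lower (hMT : IsUnitary Tᵐᵒᵖ M) (hA : IsPartition A)
    {N : ModuleCat.{u} (Dorroh (TriMat T M U))}
    (hN : Filt (stdClass (idem M e f) (joinPart A B)) N) : Filt (stdClass e A) (lower N) := by
  refine Filt.induct hΛ (P := fun N => Filt (stdClass e A) (lower N)) ?_ ?_ hN
  · intro N _
    have h : Subsingleton (uPart T M U N) := inferInstance
    have : Subsingleton (lower N) := h
    exact Filt.of_subsingleton _
  · rintro L N X i g h hN hL ⟨a | b, -, _, ⟨t, ht, rfl⟩, rfl⟩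
    · obtain ⟨φ⟩ := nonempty_stdMod_inl_equiv (A := A) (B := B) hΛ he a t
      obtain ⟨φ'⟩ := nonempty_lower_equiv hΛ (isUnitary_stdMod hΛ.idem _ _ _) φ
      exact Filt.step (isSES_lower hΛ hN h) (isUnitary_lower hMT hΛ hN) hL
        (φ'.trans (lowerPull _)) ⟨a, trivial, t, ht, rfl⟩
    · obtain ⟨φ⟩ := nonempty_stdMod_inr_equiv (A := A) (B := B) hΛ hf hA b t
      obtain ⟨φ'⟩ := nonempty_lower_equiv hΛ (isUnitary_stdMod hΛ.idem _ _ _) φ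
      have := subsingleton_lower_pullT (M := M) (U := U) hf (isUnitary_stdMod hf.idem B b t)
      have := φ'.toEquiv.subsingleton
      have h0 : Filt (stdClass e A) (lower (stdMod (idem M e f) (joinPart A B)
        (toLex (Sum.inr b)) (Sum.inr t))) := Filt.of_subsingleton _
      exact Filt.extension he (isSES_lower hΛ hN h) (isUnitary_lower hMT hΛ hN) hL h0

include hΛ he hf in
theorem filt_upper (hA : IsPartition A) {N : ModuleCat.{u} (Dorroh (TriMat T M U))}
    (hN : Filt (stdClass (idem M e f) (joinPart A B)) N) : Filt (stdClass f B) (upper N) := by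
  refine Filt.induct hΛ (P := fun N => Filt (stdClass f B) (upper N)) ?_ ?_ hN
  · intro N _
    have h : Subsingleton (N ⧸ uPart T M U N) := inferInstance
    have : Subsingleton (upper N) := h
    exact Filt.of_subsingleton _
  · rintro L N X i g h hN hL ⟨a | b, -, _, ⟨t, ht, rfl⟩, rfl⟩
    · obtain ⟨φ⟩ := nonempty_stdMod_inl_equiv (A := A) (B := B) hΛ he a t
      obtain ⟨φ'⟩ := nonempty_upper_equiv hΛ (isUnitary_stdMod hΛ.idem _ _ _) φ
      have := subsingleton_upper_pullU (T := T) (M := M) (stdMod e A a t)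
      have := φ'.toEquiv.subsingleton
      have h0 : Filt (stdClass f B) (upper (stdMod (idem M e f) (joinPart A B)
        (toLex (Sum.inl a)) (Sum.inl t))) := Filt.of_subsingleton _
      exact Filt.extension hf (isSES_upper hΛ hN h) (isUnitary_upper hN) hL h0
    · obtain ⟨φ⟩ := nonempty_stdMod_inr_equiv (A := A) (B := B) hΛ hf hA b t
      obtain ⟨φ'⟩ := nonempty_upper_equiv hΛ (isUnitary_stdMod hΛ.idem _ _ _) φ
      exact Filt.step (isSES_upper hΛ hN h) (isUnitary_upper hN) hL
        (φ'.trans (upperPull hf (isUnitary_stdMod hf.idem B b t))) ⟨b, trivial, t, ht, rfl⟩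

include hΛ he hf in
theorem filt_iff (hMT : IsUnitary Tᵐᵒᵖ M) (hA : IsPartition A)
    {N : ModuleCat.{u} (Dorroh (TriMat T M U))} (hN : IsUnitary (TriMat T M U) N) :
    Filt (stdClass (idem M e f) (joinPart A B)) N ↔
      Filt (stdClass e A) (lower N) ∧ Filt (stdClass f B) (upper N) := by
  refine ⟨fun h => ⟨filt_lower hΛ he hf hMT hA h, filt_upper hΛ he hf hA h⟩, fun h => ?_⟩
  exact Filt.extension hΛ (L := ModuleCat.of _ (uPart T M U N))
    (X := ModuleCat.of _ (N ⧸ uPart T M U N)) (isSES_mkQ (uPart T M U N)) hN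
    ((filt_pullU hΛ he h.1).of_equiv (pullLower hMT N))
    ((filt_pullT hΛ hf hA h.2).of_equiv (pullUpper N))

include hΛ he hf in
theorem filt_pullU_iff (hMT : IsUnitary Tᵐᵒᵖ M) (hA : IsPartition A)
    {Y : ModuleCat.{u} (Dorroh U)} :
    Filt (stdClass (idem M e f) (joinPart A B)) (pull (projU T M U) Y) ↔ Filt (stdClass e A) Y :=
  ⟨fun h => (filt_lower hΛ he hf hMT hA h).of_equiv (lowerPull Y), filt_pullU hΛ he⟩

include hΛ he hf in
theorem filt_pullT_iff (hA : IsPartition A) {Z : ModuleCat.{u} (Dorroh T)} (hZ : IsUnitary T Z) :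
    Filt (stdClass (idem M e f) (joinPart A B)) (pull (projT T M U) Z) ↔ Filt (stdClass f B) Z :=
  ⟨fun h => (filt_upper hΛ he hf hA h).of_equiv (upperPull hf hZ), filt_pullT hΛ hf hA⟩

/-- The two classes agree if they agree on unitary modules. -/
theorem filt_eq_finPd_iff {R : Type u} [NonUnitalRing R] {Θ : ModClass R} :
    Filt Θ = finPd R ↔
      ∀ N : ModuleCat.{u} (Dorroh R), IsUnitary R N → (Filt Θ N ↔ finPd R N) :=
  ⟨fun h N _ => by rw [h], fun h => funext fun N => propext
    ⟨fun hN => (h N hN.1).1 hN, fun hN => (h N hN.1).2 hN⟩⟩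

end Filtrations

end TriMat

end

/-! ### The main theorem -/

theorem theorem4p12 {K : Type*} [CommRing K] {U T M : Type u}
    [NonUnitalRing U] [Module K U] [IsScalarTower K U U] [SMulCommClass K U U]
    [NonUnitalRing T] [Module K T] [IsScalarTower K T T] [SMulCommClass K T T]
    [AddCommGroup M] [Module K M] [Module (Dorroh U) M] [Module (Dorroh Tᵐᵒᵖ) M]
    [SMulCommClass (Dorroh U) (Dorroh Tᵐᵒᵖ) M] [CentralAction K U M] [CentralAction K Tᵐᵒᵖ M]
    {I J : Type*} (e : I → U) (f : J → T) (he : IsBasic e K) (hf : IsBasic f K)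
    (hMU : IsUnitary U M) (hMT : IsUnitary Tᵐᵒᵖ M)
    (hM : ∀ i j, IsFiniteLength K (biCorner M f e K i j))
    (hpd : ∀ j, pd (ModuleCat.of (Dorroh U) (colMod U M f j)) < ⊤)
    (hsupp : IsSupportFinite (TriMat.idem M e f))
    (α : Ordinal.{v}) (β : Ordinal.{w}) (A : Set.Iio α → Set I) (B : Set.Iio β → Set J)
    (hA : IsPartition A) (hB : IsPartition B) :
    (Filt (stdClass (TriMat.idem M e f) (joinPart A B)) = finPd (TriMat T M U) ↔
      Filt (stdClass e A) = finPd U ∧ Filt (stdClass f B) = finPd T) ∧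
    (Filt (stdClass (TriMat.idem M e f) (joinPart A B)) = finPd (TriMat T M U) →
      (IsLocallyBounded (TriMat.idem M e f) ∧ IsLocallyBounded e ∧ IsLocallyBounded f) ∧
      (IsStandardlyStratified (TriMat.idem M e f) (joinPart A B) K ∧
        IsStandardlyStratified e A K ∧ IsStandardlyStratified f B K) ∧
      finDim (TriMat T M U) = pdClass (stdClass (TriMat.idem M e f) (joinPart A B)) ∧
      finDim T = pdClass (stdClass f B) ∧
      finDim U = pdClass (stdClass e A)) := by
  have hw := TriMat.isWEI he.wei hf.wei hMU hMT
  have hb := TriMat.isBasic he hf hMU hMT hM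
  have hse : IsSupportFinite e := TriMat.isSupportFinite_left hsupp
  have hsf : IsSupportFinite f := TriMat.isSupportFinite_right hsupp
  have hnΛ := isNoetherian_projMod hb.wei hb.homFinite hsupp.1
  have hnU := isNoetherian_projMod he.wei he.homFinite hse.1
  have hnT := isNoetherian_projMod hf.wei hf.homFinite hsf.1
  have hiff : Filt (stdClass (TriMat.idem M e f) (joinPart A B)) = finPd (TriMat T M U) ↔
      Filt (stdClass e A) = finPd U ∧ Filt (stdClass f B) = finPd T := by
    constructor
    -- Both classes over Λ restrict to the corresponding classes over U and T on inflated modules.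
    · intro h
      constructor
      · refine TriMat.filt_eq_finPd_iff.2 fun Y hY => ?_
        rw [← TriMat.filt_pullU_iff (B := B) hw he.wei hf.wei hMT hA,
          ← TriMat.finPd_pullU_iff hw hMT he.wei hY, h]
      · refine TriMat.filt_eq_finPd_iff.2 fun Z hZ => ?_
        rw [← TriMat.filt_pullT_iff hw he.wei hf.wei hA hZ,
          ← TriMat.finPd_pullT_iff hw hMU hMT he.wei hf.wei hpd hnT hZ, h]
    · rintro ⟨h1, h2⟩
      refine TriMat.filt_eq_finPd_iff.2 fun N hN => ?_
      rw [TriMat.filt_iff hw he.wei hf.wei hMT hA hN,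
        TriMat.finPd_iff hw hMU hMT he.wei hf.wei hpd hnΛ hnT hN, h1, h2]
  refine ⟨hiff, fun h => ?_⟩
  obtain ⟨h1, h2⟩ := hiff.1 h
  exact ⟨⟨hb.isLocallyBounded hsupp, he.isLocallyBounded hse, hf.isLocallyBounded hsf⟩,
    ⟨isStandardlyStratified_of_filt_eq hb (isPartition_joinPart hA hB) hnΛ h,
      isStandardlyStratified_of_filt_eq he hA hnU h1,
      isStandardlyStratified_of_filt_eq hf hB hnT h2⟩,
    finDim_eq_of_filt_eq hw h, finDim_eq_of_filt_eq hf.wei h2, finDim_eq_of_filt_eq he.wei h1⟩
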